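/- **Setting.** Let $D\subset\mathbb R^2$ be a bounded simply connected domain whose boundary $\Sigma$ is a simple closed curve, of class $C^2$ except for one corner $P_0$ with interior angle $(1-\chi)\pi$, $-1<\chi<1$, $\chi\ne 0$. Let $\Sigma=\Sigma_1\cup\Sigma_2\cup\Sigma_3$, where the arcs $\Sigma_1,\Sigma_2$ meet at $P_0$ and $\Sigma_3$ joins their other endpoints, with regular parametrizations $\sigma_i=(\xi_i,\eta_i)\in C^2([0,1])$, $|\sigma_i'|\neq0$, such that $\sigma_1(0)=\sigma_2(0)=P_0$, $\sigma_2(1)=\sigma_3(0)$, $\sigma_1(1)=\sigma_3(1)$ and $|\sigma_1'(0)|=|\sigma_2'(0)|$; $\sigma_2,\sigma_3$ run along $\Sigma$ counterclockwise and $\sigma_1$ clockwise. Put $\varepsilon_1=-1$, $\varepsilon_2=\varepsilon_3=1$ and, for $t,s\in[0,1]$, $$K^{i,j}(t,s)=\varepsilon_j\begin{cases}\dfrac{\eta_j'(t)[\xi_i(s)-\xi_j(t)]-\xi_j'(t)[\eta_i(s)-\eta_j(t)]}{[\xi_i(s)-\xi_j(t)]^2+[\eta_i(s)-\eta_j(t)]^2},&\sigma_i(s)\ne\sigma_j(t),\\[3mm]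 \dfrac12\,\dfrac{\eta_j'(t)\xi_j''(t)-\xi_j'(t)\eta_j''(t)}{\xi_j'(t)^2+\eta_j'(t)^2},&\sigma_i(s)=\sigma_j(t),\end{cases}$$ (the double layer kernel $|\sigma_j'(t)|\,\partial_{\mathbf n_Q}\log|P-Q|$ with $P=\sigma_i(s)$, $Q=\sigma_j(t)$ and inner normal $\mathbf n_Q$), $$L(t,s)=-\frac{s\sin(\chi\pi)}{s^2+2ts\cos(\chi\pi)+t^2},\quad L(0,0)=0,\qquad M^{i,j}=K^{i,j}-L\quad\text{for }(i,j)\in\{(1,2),(2,1)\}.$$ Assume that the kernels $M^{1,2}$ and $M^{2,1}$ are continuous at the corner point $(t,s)=(0,0)$ of $[0,1]^2$. Let $\mathcal K^{i,j}$ and $\mathcal L$ be the integral operators $\rho\mapsto\int_0^1K^{i,j}(t,\cdot)\rho(t)\,dt$ and $\rho\mapsto\int_0^1L(t,\cdot)\rho(t)\,dt$, let $\bar\Omega_1(s)=\bar\Omega_2(s)=\pi$ for $0<s\le1$, $\bar\Omega_1(0)=\bar\Omega_2(0)=(1-\chi)\pi$, and let $$\mathcal K=\begin{pmatrix}(-\pi+\bar\Omega_1)I+\mathcal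 K^{1,1}&\mathcal K^{1,2}&\mathcal K^{1,3}\\ \mathcal K^{2,1}&(-\pi+\bar\Omega_2)I+\mathcal K^{2,2}&\mathcal K^{2,3}\\ \mathcal K^{3,1}&\mathcal K^{3,2}&\mathcal K^{3,3}\end{pmatrix},\quad \mathcal W=\begin{pmatrix}(-\pi+\bar\Omega_1)I&\mathcal L&0\\ \mathcal L&(-\pi+\bar\Omega_2)I&0\\0&0&0\end{pmatrix},\quad \mathcal S=\mathcal K-\mathcal W .$$ For $m\in\mathbb N=\{0,1,2,\dots\}$ let $x_0=0$, $x_{m+1}=1$, let $x_1<\dots<x_m$ be the zeros of the polynomial of degree $m$ orthogonal on $[0,1]$ with respect to the weight $v(x)=x(1-x)$, and let $$\lambda_0=\lambda_{m+1}=\frac1{(m+1)(m+2)},\qquad \lambda_k=\int_0^1\frac{l_k(x)v(x)}{v(x_k)}\,dx\quad(1\le k\le m),$$ where $l_k$ is the $k$-th fundamental Lagrange polynomial based on $x_1,\dots,x_m$ (the Lobatto rule). Set $$(\mathcal K^{i,j}_m\rho)(s)=\sum_{h=0}^{m+1}\lambda_hK^{i,j}(x_h,s)\rho(x_h),\qquad(\mathcal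 M^{i,j}_m\rho)(s)=\sum_{h=0}^{m+1}\lambda_hM^{i,j}(x_h,s)\rho(x_h),$$ $$\mathcal S_m=\begin{pmatrix}\mathcal K_m^{1,1}&\mathcal M_m^{1,2}&\mathcal K_m^{1,3}\\ \mathcal M_m^{2,1}&\mathcal K_m^{2,2}&\mathcal K_m^{2,3}\\ \mathcal K_m^{3,1}&\mathcal K_m^{3,2}&\mathcal K_m^{3,3}\end{pmatrix}.$$ Finally let $\mathcal X=\{(f_1,f_2,f_3)\in C([0,1])^3: f_1(0)=f_2(0)\}$ with the norm $\|f\|_\infty=\max_i\|f_i\|_\infty$. **Theorem.** $\mathcal S$ and all the $\mathcal S_m$ are bounded linear operators from $\mathcal X$ into $\mathcal X$; the set $\{\mathcal S_m\}_{m\in\mathbb N}$ is collectively compact, that is, for every bounded $U\subset\mathcal X$ the set $\{\mathcal S_m\rho:\ m\in\mathbb N,\ \rho\in U\}$ is relatively compact in $\mathcal X$; and $$\lim_{m\to\infty}\|(\mathcal S_m-\mathcal S)\rho\|_\infty=0\qquad\text{for all }\rho\in\mathcal X .$$ -/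

import Mathlib

open Set Filter Topology MeasureTheory Polynomial

noncomputable section

/-! ### The Lobatto quadrature rule on `[0,1]` -/

/-- The Jacobi weight `v(x) = x (1 - x)`. -/
def jacobiWeight (x : ℝ) : ℝ := x * (1 - x)

/-- The inner product `∫₀¹ p q v` of polynomials. -/
def jacobiInner (p q : ℝ[X]) : ℝ :=
  ∫ x in (0 : ℝ)..1, p.eval x * q.eval x * jacobiWeight x

/-- The monic orthogonal polynomial of degree `m` for the weight `v` on `[0,1]`
(Gram-Schmidt applied to the monomials). -/
def jacobiPoly (m : ℕ) : ℝ[X] :=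
  X ^ m - ∑ k : Fin m,
    C (jacobiInner (X ^ m) (jacobiPoly k) / jacobiInner (jacobiPoly k) (jacobiPoly k)) *
      jacobiPoly k
termination_by m
decreasing_by exact k.isLt

/-- The interior Lobatto nodes: the zeros of the `m`-th orthogonal polynomial. -/
def lobattoInterior (m : ℕ) : Finset ℝ := (jacobiPoly m).roots.toFinset

/-- All `m + 2` Lobatto nodes: the interior ones and the endpoints `0` and `1`. -/
def lobattoNodes (m : ℕ) : Finset ℝ := insert 0 (insert 1 (lobattoInterior m))

/-- The Lobatto coefficient attached to the node `x`; the Lagrange polynomials are those of the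
interior nodes only. -/
def lobattoCoeff (m : ℕ) (x : ℝ) : ℝ :=
  if x = 0 ∨ x = 1 then 1 / (((m : ℝ) + 1) * ((m : ℝ) + 2))
  else ∫ t in (0 : ℝ)..1,
    (Lagrange.basis (lobattoInterior m) id x).eval t * jacobiWeight t / jacobiWeight x

/-- The Lobatto quadrature sum of `f` with `m + 2` nodes. -/
def lobattoSum (m : ℕ) (f : ℝ → ℝ) : ℝ :=
  ∑ x ∈ lobattoNodes m, lobattoCoeff m x * f x

/-! ### The function space -/

/-- `C([0,1])³` with the norm `max_i ‖f_i‖_∞`. -/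
abbrev TripleC : Type := Fin 3 → C(Icc (0 : ℝ) 1, ℝ)

/-- The values of a function in `C([0,1])` at real numbers: for `t ∈ [0,1]` this is `f t`
(and only such `t` are used). -/
def valueAt (f : C(Icc (0 : ℝ) 1, ℝ)) (t : ℝ) : ℝ := IccExtend zero_le_one f t

/-- The closed subspace `𝒳 = {(f₁, f₂, f₃) | f₁(0) = f₂(0)}` of `C([0,1])³`.
The indices `1, 2, 3` are `0, 1, 2 : Fin 3` here and below. -/
def spaceX : Submodule ℝ TripleC where
  carrier := {f | valueAt (f 0) 0 = valueAt (f 1) 0}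
  add_mem' := by
    intro f g hf hg
    simp only [valueAt, IccExtend, Function.comp, mem_ofPred_eq, Pi.add_apply,
      ContinuousMap.add_apply] at hf hg ⊢
    rw [hf, hg]
  zero_mem' := by simp [valueAt, IccExtend]
  smul_mem' := by
    intro c f hf
    simp only [valueAt, IccExtend, Function.comp, mem_ofPred_eq, Pi.smul_apply,
      ContinuousMap.smul_apply] at hf ⊢
    rw [hf]

/-- A set of operators is collectively compact if the union of the images of each bounded set is
relatively compact. -/
def CollectivelyCompact {E F : Type*} [NormedAddCommGroup E] [NormedSpace ℝ E]
    [NormedAddCommGroup F] [NormedSpace ℝ F] (A : Set (E →L[ℝ] F)) : Prop :=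
  ∀ U : Set E, Bornology.IsBounded U → IsCompact (closure {y | ∃ T ∈ A, ∃ x ∈ U, T x = y})

/-! ### Plane domains with one corner -/

/-- First derivative of a plane arc on `[0,1]` (one-sided at the endpoints). -/
def arcD1 (σ : ℝ → ℂ) (t : ℝ) : ℂ := derivWithin σ (Icc 0 1) t

/-- Second derivative of a plane arc on `[0,1]` (one-sided at the endpoints). -/
def arcD2 (σ : ℝ → ℂ) (t : ℝ) : ℂ := derivWithin (arcD1 σ) (Icc 0 1) t

/-- Unit tangent vector `σ' / |σ'|`. -/
def arcTangent (σ : ℝ → ℂ) (t : ℝ) : ℂ := arcD1 σ t / (‖arcD1 σ t‖ : ℂ)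

/-- Signed curvature `(ξ' η'' - η' ξ'') / |σ'|³`, where `σ = (ξ, η)`. -/
def arcCurvature (σ : ℝ → ℂ) (t : ℝ) : ℝ :=
  ((arcD1 σ t).re * (arcD2 σ t).im - (arcD1 σ t).im * (arcD2 σ t).re) / ‖arcD1 σ t‖ ^ 3

/-- The first arc runs against the counterclockwise orientation of the boundary, the other two
along it. -/
def orient (j : Fin 3) : ℝ := if j = 0 then -1 else 1

/-- A bounded simply connected plane domain `D` whose boundary is a simple closed curve that is
of class `C²` except for one corner, of interior angle `(1 - χ) π`, together with a
subdivision of the boundary into three `C²` arcs. The plane is `ℂ`. The arcs `σ 0` and `σ 1` start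
at the corner, `σ 1`, `σ 2` and the reversed arc `σ 0` traverse the boundary
counterclockwise. -/
structure CornerDomain where
  χ : ℝ
  neg_one_lt_χ : -1 < χ
  χ_lt_one : χ < 1
  χ_ne_zero : χ ≠ 0
  /-- the domain -/
  D : Set ℂ
  isOpen_D : IsOpen D
  isBounded_D : Bornology.IsBounded D
  simplyConnected_D : SimplyConnectedSpace D
  /-- the parametrizations of the three arcs; only their values on `[0,1]` matter -/
  σ : Fin 3 → ℝ → ℂ
  frontier_D : frontier D = ⋃ i, σ i '' Icc 0 1
  contDiffOn_σ : ∀ i, ContDiffOn ℝ 2 (σ i) (Icc 0 1)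
  regular : ∀ i, ∀ t ∈ Icc (0 : ℝ) 1, arcD1 (σ i) t ≠ 0
  -- The three arcs form a simple closed curve.
  injOn_σ : ∀ i, InjOn (σ i) (Icc 0 1)
  corner : σ 0 0 = σ 1 0
  join_one_two : σ 1 1 = σ 2 0
  join_zero_two : σ 0 1 = σ 2 1
  inter_zero_one : σ 0 '' Icc 0 1 ∩ σ 1 '' Icc 0 1 ⊆ {σ 0 0}
  inter_one_two : σ 1 '' Icc 0 1 ∩ σ 2 '' Icc 0 1 ⊆ {σ 1 1}
  inter_zero_two : σ 0 '' Icc 0 1 ∩ σ 2 '' Icc 0 1 ⊆ {σ 0 1}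
  -- The normal to the left of the counterclockwise direction is the inner one.
  inner_normal : ∀ i, ∀ t ∈ Ioo (0 : ℝ) 1, ∀ᶠ r : ℝ in 𝓝[>] 0,
    σ i t + (r * orient i : ℝ) * (Complex.I * arcD1 (σ i) t) ∈ D
  -- The angle at the corner inside `D`, measured counterclockwise from the arc `σ 1` to the
  -- arc `σ 0`, is `(1 - χ) π`, and both arcs start with the same speed.
  angle : arcD1 (σ 0) 0 =
    Complex.exp (((1 - χ) * Real.pi : ℝ) * Complex.I) * arcD1 (σ 1) 0
  -- The curve is `C²` at the two joints (reversing an arc changes the sign of its tangent and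
  -- of its curvature).
  tangent_one_two : arcTangent (σ 1) 1 = arcTangent (σ 2) 0
  curvature_one_two : arcCurvature (σ 1) 1 = arcCurvature (σ 2) 0
  tangent_two_zero : arcTangent (σ 2) 1 = -arcTangent (σ 0) 1
  curvature_two_zero : arcCurvature (σ 2) 1 = -arcCurvature (σ 0) 1

namespace CornerDomain

variable (Γ : CornerDomain)

/-- The double layer kernel `K^{i,j}(t,s)`, that is, `∂/∂n_Q log |P - Q| |σ_j'(t)|` with
`P = σ_i(s)`, `Q = σ_j(t)` and `n_Q` the inner normal. Where `P = Q`, the quotient is replaced by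
the curvature term of the arc `j` at `t`. -/
def K (i j : Fin 3) (t s : ℝ) : ℝ :=
  orient j *
    (if Γ.σ i s = Γ.σ j t then
      1 / 2 * (((arcD1 (Γ.σ j) t).im * (arcD2 (Γ.σ j) t).re
          - (arcD1 (Γ.σ j) t).re * (arcD2 (Γ.σ j) t).im)
        / ((arcD1 (Γ.σ j) t).re ^ 2 + (arcD1 (Γ.σ j) t).im ^ 2))
    else
      ((arcD1 (Γ.σ j) t).im * ((Γ.σ i s).re - (Γ.σ j t).re)
          - (arcD1 (Γ.σ j) t).re * ((Γ.σ i s).im - (Γ.σ j t).im))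
        / (((Γ.σ i s).re - (Γ.σ j t).re) ^ 2 + ((Γ.σ i s).im - (Γ.σ j t).im) ^ 2))

/-- The Mellin-type kernel `L(t,s)` of the wedge; its value at `t = s = 0` is `0`. -/
def L (t s : ℝ) : ℝ :=
  -(s * Real.sin (Γ.χ * Real.pi)) /
    (s ^ 2 + 2 * t * s * Real.cos (Γ.χ * Real.pi) + t ^ 2)

/-- The kernel `M^{i,j} = K^{i,j} - L`, used for `(i,j) = (1,2), (2,1)`. Its value at `(0,0)` is
the curvature term of the arc `j` at the corner, the only one compatible with continuity,
since `M^{i,j}(t,0) = K^{i,j}(t,0) = K^{j,j}(t,0)` for `t > 0`. -/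
def M (i j : Fin 3) (t s : ℝ) : ℝ := Γ.K i j t s - Γ.L t s

/-- The interior angle `Ω` of the boundary at `σ_i(s)`. -/
def Ω (i : Fin 3) (s : ℝ) : ℝ :=
  if i ≠ 2 ∧ s = 0 then (1 - Γ.χ) * Real.pi else Real.pi

/-- The matrix operator `𝒦`, as a formula. -/
def opK (ρ : TripleC) (i : Fin 3) (s : ℝ) : ℝ :=
  (-Real.pi + Γ.Ω i s) * valueAt (ρ i) s
    + ∑ j, ∫ t in (0 : ℝ)..1, Γ.K i j t s * valueAt (ρ j) t

/-- The operator `ℒ` with the Mellin-type kernel. -/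
def opL (f : C(Icc (0 : ℝ) 1, ℝ)) (s : ℝ) : ℝ :=
  ∫ t in (0 : ℝ)..1, Γ.L t s * valueAt f t

/-- The matrix operator `𝒲`, as a formula. -/
def opW (ρ : TripleC) (i : Fin 3) (s : ℝ) : ℝ :=
  ![(-Real.pi + Γ.Ω 0 s) * valueAt (ρ 0) s + Γ.opL (ρ 1) s,
    Γ.opL (ρ 0) s + (-Real.pi + Γ.Ω 1 s) * valueAt (ρ 1) s,
    0] i

/-- The matrix operator `𝒮 = 𝒦 - 𝒲`, as a formula. -/
def opS (ρ : TripleC) (i : Fin 3) (s : ℝ) : ℝ := Γ.opK ρ i s - Γ.opW ρ i s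

/-- `𝒦_m^{i,j}`: the Lobatto discretization of the integral operator with kernel `K^{i,j}`. -/
def discK (m : ℕ) (i j : Fin 3) (f : C(Icc (0 : ℝ) 1, ℝ)) (s : ℝ) : ℝ :=
  lobattoSum m fun t => Γ.K i j t s * valueAt f t

/-- `ℳ_m^{i,j}`: the Lobatto discretization of the integral operator with kernel `M^{i,j}`. -/
def discM (m : ℕ) (i j : Fin 3) (f : C(Icc (0 : ℝ) 1, ℝ)) (s : ℝ) : ℝ :=
  lobattoSum m fun t => Γ.M i j t s * valueAt f t

/-- The matrix operator `𝒮_m`, as a formula. -/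
def discS (m : ℕ) (ρ : TripleC) (i : Fin 3) (s : ℝ) : ℝ :=
  ![Γ.discK m 0 0 (ρ 0) s + Γ.discM m 0 1 (ρ 1) s + Γ.discK m 0 2 (ρ 2) s,
    Γ.discM m 1 0 (ρ 0) s + Γ.discK m 1 1 (ρ 1) s + Γ.discK m 1 2 (ρ 2) s,
    Γ.discK m 2 0 (ρ 0) s + Γ.discK m 2 1 (ρ 1) s + Γ.discK m 2 2 (ρ 2) s] i

end CornerDomain

end

/-! Once `L` is subtracted in the two corner blocks, all nine kernels are continuous on the square,
so `𝒮` is an integral operator with continuous kernels and each `𝒮_m` is its quadrature version. The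
rest is Anselone's argument: the rules are uniformly bounded functionals converging pointwise to the
integral.

Quadrature. The `m`-th orthogonal polynomial is a multiple of `P'`, where `P` is the shifted
Legendre polynomial of degree `m + 1`. This gives the end weights, exactness up to degree `m + 1`
(`lobattoSum_eval`) and, by a Gauss-type argument, nonnegative weights (`lobattoCoeff_nonneg`).
Since the weights sum to one, the functionals have norm at most one, and Weierstrass approximation
yields convergence (`tendsto_lobattoCLM`).

Kernels. On a single arc, the Taylor formula cancels the singularity
(`continuousOn_planeCross_div`). At a smooth joint of two arcs, equality of tangents and curvatures
gives the limit (`tendsto_planeCross_div`). At the corner, continuity is the hypothesis on `M`.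

Operators. A kernel continuous in `s` with values in the sup norm gives a modulus of continuity
independent of `m`. Arzelà-Ascoli then gives collective compactness, and equicontinuity turns
pointwise into uniform convergence. The images lie in `𝒳` because the first two arcs share the
corner point and `L(t,0) = 0`; the terms `-π + Ω` cancel in `𝒦 - 𝒲`. -/

/-! ### Integration of polynomials over `[0,1]` -/

/-- Integration of polynomials over `[0,1]`. -/
noncomputable def polyIntegral : ℝ[X] →ₗ[ℝ] ℝ where
  toFun p := ∫ x in (0 : ℝ)..1, p.eval x
  map_add' p q := by
    simp only [eval_add]
    exact intervalIntegral.integral_add (p.continuous.intervalIntegrable _ _)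
      (q.continuous.intervalIntegrable _ _)
  map_smul' c p := by simp

theorem polyIntegral_apply (p : ℝ[X]) : polyIntegral p = ∫ x in (0 : ℝ)..1, p.eval x := rfl

theorem polyIntegral_derivative (p : ℝ[X]) :
    polyIntegral (derivative p) = p.eval 1 - p.eval 0 :=
  intervalIntegral.integral_eq_sub_of_hasDerivAt (fun x _ => p.hasDerivAt x)
    ((derivative p).continuous.intervalIntegrable _ _)

/-- The Jacobi weight as a polynomial. -/
noncomputable def weightPoly : ℝ[X] := X * (1 - X)

theorem eval_weightPoly (x : ℝ) : weightPoly.eval x = jacobiWeight x := by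
  simp [weightPoly, jacobiWeight]

theorem jacobiInner_eq (p q : ℝ[X]) : jacobiInner p q = polyIntegral (p * q * weightPoly) := by
  simp [jacobiInner, polyIntegral_apply, eval_weightPoly]

theorem natDegree_weightPoly_le : weightPoly.natDegree ≤ 2 := by
  rw [weightPoly]; compute_degree

theorem jacobiWeight_pos {x : ℝ} (h : x ∈ Ioo (0 : ℝ) 1) : 0 < jacobiWeight x :=
  mul_pos h.1 (sub_pos.2 h.2)

theorem jacobiWeight_nonneg {x : ℝ} (h : x ∈ Icc (0 : ℝ) 1) : 0 ≤ jacobiWeight x :=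
  mul_nonneg h.1 (sub_nonneg.2 h.2)

theorem exists_eval_ne_zero {p : ℝ[X]} (hp : p ≠ 0) : ∃ x ∈ Ioo (0 : ℝ) 1, p.eval x ≠ 0 := by
  by_contra! h
  exact hp (Polynomial.eq_zero_of_infinite_isRoot p
    ((Ioo_infinite (zero_lt_one' ℝ)).mono fun x hx => h x hx))

/-- A polynomial which is nonnegative on `[0,1]` and not zero has positive integral. -/
theorem polyIntegral_pos {p : ℝ[X]} (hp : p ≠ 0) (h : ∀ x ∈ Icc (0 : ℝ) 1, 0 ≤ p.eval x) :
    0 < polyIntegral p := by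
  obtain ⟨x, hx, hne⟩ := exists_eval_ne_zero hp
  exact intervalIntegral.integral_pos zero_lt_one p.continuous.continuousOn
    (fun y hy => h y (Ioc_subset_Icc_self hy))
    ⟨x, Ioo_subset_Icc_self hx, lt_of_le_of_ne (h x (Ioo_subset_Icc_self hx)) hne.symm⟩

theorem weightPoly_ne_zero : weightPoly ≠ 0 := by
  intro h
  have := eval_weightPoly (1 / 2)
  rw [h] at this
  norm_num [jacobiWeight] at this

theorem polyIntegral_sq_pos {p : ℝ[X]} (hp : p ≠ 0) : 0 < polyIntegral (p * p * weightPoly) := by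
  refine polyIntegral_pos (mul_ne_zero (mul_ne_zero hp hp) weightPoly_ne_zero) fun x hx => ?_
  simp only [eval_mul, eval_weightPoly]
  exact mul_nonneg (mul_self_nonneg _) (jacobiWeight_nonneg hx)

/-! ### Legendre polynomials -/

/-- The polynomial `xⁿ (1 - x)ⁿ` of the Rodrigues formula. -/
noncomputable def rodrigues (n : ℕ) : ℝ[X] := X ^ n * (1 - X) ^ n

theorem eval_zero_iterate_derivative_rodrigues {n k : ℕ} (hk : k < n) :
    (derivative^[k] (rodrigues n)).eval 0 = 0 := by
  have h : X ^ (n - k) ∣ derivative^[k] (rodrigues n) :=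
    pow_sub_dvd_iterate_derivative_of_pow_dvd k (dvd_mul_right _ _)
  have := eval_dvd (x := (0 : ℝ)) h
  simpa [zero_pow (Nat.sub_ne_zero_of_lt hk)] using this

theorem eval_one_iterate_derivative_rodrigues {n k : ℕ} (hk : k < n) :
    (derivative^[k] (rodrigues n)).eval 1 = 0 := by
  have h : (1 - X) ^ (n - k) ∣ derivative^[k] (rodrigues n) :=
    pow_sub_dvd_iterate_derivative_of_pow_dvd k (dvd_mul_left _ _)
  have := eval_dvd (x := (1 : ℝ)) h
  simpa [zero_pow (Nat.sub_ne_zero_of_lt hk)] using this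

/-- Integration by parts for the Rodrigues formula. -/
theorem polyIntegral_iterate_derivative_rodrigues {n k : ℕ} (hk : k ≤ n) (q : ℝ[X]) :
    polyIntegral (derivative^[k] (rodrigues n) * q) =
      (-1) ^ k * polyIntegral (rodrigues n * derivative^[k] q) := by
  induction k generalizing q with
  | zero => simp
  | succ k ih =>
    have h := polyIntegral_derivative (derivative^[k] (rodrigues n) * q)
    rw [derivative_mul, map_add, ih (by omega), eval_mul, eval_mul,
      eval_zero_iterate_derivative_rodrigues hk, eval_one_iterate_derivative_rodrigues hk] at h
    rw [Function.iterate_succ_apply', Function.iterate_succ_apply, pow_succ]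
    linarith

/-- The shifted Legendre polynomial with real coefficients. -/
noncomputable def legendreReal (n : ℕ) : ℝ[X] := (shiftedLegendre n).map (Int.castRingHom ℝ)

theorem factorial_mul_legendreReal (n : ℕ) :
    C (n.factorial : ℝ) * legendreReal n = derivative^[n] (rodrigues n) := by
  have h := congrArg (Polynomial.map (Int.castRingHom ℝ)) (factorial_mul_shiftedLegendre_eq n)
  rw [← iterate_derivative_map] at h
  simpa [legendreReal, rodrigues] using h

/-- After `n` integrations by parts in the Rodrigues formula, the `n`-th derivative of `q` appears,
and it is zero. -/
theorem polyIntegral_legendreReal_mul {n : ℕ} {q : ℝ[X]} (hq : q.natDegree < n) :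
    polyIntegral (legendreReal n * q) = 0 := by
  have h := polyIntegral_iterate_derivative_rodrigues le_rfl (n := n) q
  rw [iterate_derivative_eq_zero hq, ← factorial_mul_legendreReal, mul_assoc, C_mul',
    map_smul] at h
  simpa [Nat.factorial_ne_zero] using h

theorem natDegree_legendreReal (n : ℕ) : (legendreReal n).natDegree = n := by
  rw [legendreReal, natDegree_map_eq_of_injective (RingHom.injective_int _),
    natDegree_shiftedLegendre]

theorem eval_zero_legendreReal (n : ℕ) : (legendreReal n).eval 0 = 1 := by
  rw [← coeff_zero_eq_eval_zero, legendreReal, coeff_map, coeff_shiftedLegendre]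
  simp

/-- The source of the Lobatto end weight: for `n = m + 1` the value is `-(m + 1)(m + 2)`. -/
theorem eval_zero_derivative_legendreReal (n : ℕ) :
    (derivative (legendreReal n)).eval 0 = -(n * (n + 1)) := by
  rw [← coeff_zero_eq_eval_zero, coeff_derivative, legendreReal, coeff_map, coeff_shiftedLegendre,
    zero_add, Nat.choose_symm_add]
  simp

/-- The reflection `x ↦ 1 - x` transfers the values at `0` to the endpoint `1`. -/
theorem legendreReal_comp (n : ℕ) :
    (legendreReal n).comp (1 - X) = C ((-1) ^ n) * legendreReal n := by
  have h := congrArg (Polynomial.map (Int.castRingHom ℝ))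
    (neg_one_pow_mul_shiftedLegendre_comp_one_sub_X_eq n)
  rw [Polynomial.map_mul, Polynomial.map_comp] at h
  change _ = legendreReal n at h
  nth_rewrite 2 [← h]
  simp [legendreReal, ← mul_assoc, ← mul_pow]

theorem eval_one_legendreReal (n : ℕ) : (legendreReal n).eval 1 = (-1) ^ n := by
  have h := congrArg (Polynomial.eval 0) (legendreReal_comp n)
  simpa [eval_comp, eval_zero_legendreReal] using h

theorem eval_one_derivative_legendreReal (n : ℕ) :
    (derivative (legendreReal n)).eval 1 = (-1) ^ n * (n * (n + 1)) := by
  have h := congrArg (fun p => (derivative p).eval 0) (legendreReal_comp n)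
  simp only [derivative_comp, derivative_sub, derivative_one, derivative_X, derivative_C_mul,
    eval_mul, eval_comp, eval_C, eval_zero_derivative_legendreReal] at h
  simp only [zero_sub, eval_neg, eval_one, eval_sub, eval_X, sub_zero] at h
  linarith

/-! ### The monic orthogonal polynomials -/

/-- The monic multiple of the derivative of the Legendre polynomial of degree `m + 1`. -/
noncomputable def legendreDeriv (m : ℕ) : ℝ[X] :=
  C (derivative (legendreReal (m + 1))).leadingCoeff⁻¹ * derivative (legendreReal (m + 1))

theorem derivative_legendreReal_ne_zero (m : ℕ) : derivative (legendreReal (m + 1)) ≠ 0 := by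
  intro h
  have := eval_zero_derivative_legendreReal (m + 1)
  rw [h, eval_zero, Nat.cast_add_one] at this
  have : (0 : ℝ) < (m + 1) * (m + 1 + 1) := by positivity
  linarith

theorem monic_legendreDeriv (m : ℕ) : (legendreDeriv m).Monic := by
  rw [legendreDeriv, mul_comm]
  exact monic_mul_leadingCoeff_inv (derivative_legendreReal_ne_zero m)

theorem natDegree_legendreDeriv (m : ℕ) : (legendreDeriv m).natDegree = m := by
  rw [legendreDeriv, natDegree_C_mul
    (inv_ne_zero (leadingCoeff_ne_zero.2 (derivative_legendreReal_ne_zero m))),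
    natDegree_derivative, natDegree_legendreReal, Nat.add_sub_cancel]

theorem polyIntegral_derivative_mul (p q : ℝ[X]) :
    polyIntegral (derivative p * q) =
      p.eval 1 * q.eval 1 - p.eval 0 * q.eval 0 - polyIntegral (p * derivative q) := by
  have h := polyIntegral_derivative (p * q)
  rw [derivative_mul, map_add, eval_mul, eval_mul] at h
  linarith

/-- The weight vanishes at both endpoints, so integration by parts leaves only the Legendre
polynomial of degree `m + 1` against `(q v)'`, whose degree is at most `m`. -/
theorem legendreDeriv_orthogonal {m : ℕ} {q : ℝ[X]} (hq : q.degree < m) :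
    polyIntegral (legendreDeriv m * q * weightPoly) = 0 := by
  rcases eq_or_ne q 0 with rfl | hq0
  · simp
  have hq' : q.natDegree < m := (natDegree_lt_iff_degree_lt hq0).2 hq
  rw [legendreDeriv, mul_assoc, mul_assoc, C_mul', map_smul, polyIntegral_derivative_mul,
    polyIntegral_legendreReal_mul]
  · simp [weightPoly]
  · have h1 := natDegree_derivative_le (q * weightPoly)
    have h2 := natDegree_mul_le (p := q) (q := weightPoly)
    have := natDegree_weightPoly_le
    omega

theorem jacobiInner_legendreDeriv_self_pos (m : ℕ) :
    0 < jacobiInner (legendreDeriv m) (legendreDeriv m) := by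
  rw [jacobiInner_eq]
  exact polyIntegral_sq_pos (monic_legendreDeriv m).ne_zero

theorem jacobiInner_comm (p q : ℝ[X]) : jacobiInner p q = jacobiInner q p := by
  rw [jacobiInner_eq, jacobiInner_eq, mul_comm p q]

theorem jacobiInner_legendreDeriv_of_ne {k l : ℕ} (h : k ≠ l) :
    jacobiInner (legendreDeriv k) (legendreDeriv l) = 0 := by
  wlog hkl : l < k generalizing k l
  · rw [jacobiInner_comm]
    exact this h.symm (by omega)
  rw [jacobiInner_eq]
  refine legendreDeriv_orthogonal ?_
  rw [degree_eq_natDegree (monic_legendreDeriv l).ne_zero, natDegree_legendreDeriv]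
  exact_mod_cast hkl

/-- A polynomial of degree less than `m` orthogonal to the first `m` orthogonal polynomials
is zero. -/
theorem eq_zero_of_jacobiInner_legendreDeriv {m : ℕ} {d : ℝ[X]} (hd : d.degree < m)
    (h : ∀ k < m, jacobiInner d (legendreDeriv k) = 0) : d = 0 := by
  by_contra hd0
  set k := d.natDegree with hk
  have hkm : k < m := (natDegree_lt_iff_degree_lt hd0).2 hd
  -- Removing the leading term of `d` leaves a polynomial orthogonal to `legendreDeriv k`. As `d`
  -- itself is orthogonal to it too, the leading coefficient would have to vanish.
  have hlt : (d - C d.leadingCoeff * legendreDeriv k).degree < (k : WithBot ℕ) := by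
    rw [hk, ← degree_eq_natDegree hd0]
    refine degree_sub_lt_left ?_ hd0 ?_
    · rw [degree_C_mul (leadingCoeff_ne_zero.2 hd0), degree_eq_natDegree hd0,
        degree_eq_natDegree (monic_legendreDeriv _).ne_zero, natDegree_legendreDeriv]
    · rw [leadingCoeff_mul, leadingCoeff_C, (monic_legendreDeriv _).leadingCoeff, mul_one]
  have h1 := legendreDeriv_orthogonal hlt
  have h2 := h k hkm
  have h3 := jacobiInner_legendreDeriv_self_pos k
  rw [jacobiInner_eq] at h2 h3
  have : legendreDeriv k * (d - C d.leadingCoeff * legendreDeriv k) * weightPoly =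
      d * legendreDeriv k * weightPoly -
        d.leadingCoeff • (legendreDeriv k * legendreDeriv k * weightPoly) := by
    rw [← C_mul']; ring
  rw [this, map_sub, map_smul, h2, zero_sub, neg_eq_zero, smul_eq_mul] at h1
  exact (mul_ne_zero (leadingCoeff_ne_zero.2 hd0) h3.ne') h1

/-- Both polynomials are monic of degree `m`, so their difference has lower degree, and it is
orthogonal to all earlier orthogonal polynomials: on one side by Gram-Schmidt, on the other by
integration by parts. -/
theorem jacobiPoly_eq_legendreDeriv (m : ℕ) : jacobiPoly m = legendreDeriv m := by
  induction m using Nat.strong_induction_on with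
  | _ m ih =>
    rw [jacobiPoly, Finset.sum_congr rfl (g := fun k : Fin m =>
      C (jacobiInner (X ^ m) (legendreDeriv k) /
        jacobiInner (legendreDeriv k) (legendreDeriv k)) * legendreDeriv k)
      fun k _ => by rw [ih k k.isLt], ← sub_eq_zero]
    refine eq_zero_of_jacobiInner_legendreDeriv (m := m) ?_ fun k hk => ?_
    · rw [sub_right_comm]
      refine (degree_sub_le _ _).trans_lt (max_lt ?_ ?_)
      · have : (X ^ m - legendreDeriv m : ℝ[X]).degree < (X ^ m : ℝ[X]).degree := by
          refine degree_sub_lt_left ?_ (monic_X_pow m).ne_zero ?_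
          · rw [degree_X_pow, degree_eq_natDegree (monic_legendreDeriv _).ne_zero,
              natDegree_legendreDeriv]
          · rw [(monic_X_pow m).leadingCoeff, (monic_legendreDeriv _).leadingCoeff]
        rwa [degree_X_pow] at this
      · refine (degree_sum_le _ _).trans_lt ((Finset.sup_lt_iff (WithBot.bot_lt_coe m)).2 ?_)
        intro k _
        rw [C_mul']
        refine (degree_smul_le _ _).trans_lt ?_
        rw [degree_eq_natDegree (monic_legendreDeriv _).ne_zero, natDegree_legendreDeriv]
        exact Nat.cast_lt.2 k.isLt
    · have hsum : ∀ c : Fin m → ℝ,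
          jacobiInner (X ^ m - ∑ l : Fin m, C (c l) * legendreDeriv l - legendreDeriv m)
            (legendreDeriv k) = jacobiInner (X ^ m) (legendreDeriv k)
              - ∑ l : Fin m, c l * jacobiInner (legendreDeriv l) (legendreDeriv k)
              - jacobiInner (legendreDeriv m) (legendreDeriv k) := by
        intro c
        simp only [jacobiInner_eq, sub_mul, Finset.sum_mul, map_sub, map_sum, mul_assoc, C_mul',
          map_smul, smul_eq_mul, smul_mul_assoc]
      rw [hsum, jacobiInner_legendreDeriv_of_ne hk.ne', sub_zero,
        Finset.sum_eq_single ⟨k, hk⟩]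
      · rw [div_mul_cancel₀ _ (jacobiInner_legendreDeriv_self_pos k).ne', sub_self]
      · intro l _ hl
        rw [jacobiInner_legendreDeriv_of_ne (fun h => hl (Fin.ext h)), mul_zero]
      · simp

/-! ### Zeros of the orthogonal polynomials -/

theorem iterate_derivative_rodrigues_ne_zero {n k : ℕ} (hk : k ≤ n) :
    derivative^[k] (rodrigues n) ≠ 0 := by
  intro h
  have h1 := factorial_mul_legendreReal n
  rw [← Nat.sub_add_cancel hk, Function.iterate_add_apply, Nat.sub_add_cancel hk, h,
    iterate_derivative_zero] at h1
  have h2 := congrArg (Polynomial.eval 0) h1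
  simp [eval_zero_legendreReal, Nat.factorial_ne_zero] at h2

/-- Rolle's theorem produces `k + 1` new zeros strictly between the old `k + 2`, and the endpoints
`0` and `1` remain zeros as long as the order of differentiation is below `n`. -/
theorem card_roots_iterate_derivative_rodrigues {n k : ℕ} (hk : k < n) :
    k + 2 ≤ (derivative^[k] (rodrigues n)).roots.toFinset.card := by
  have hmem : ∀ l < n, ∀ x ∈ ({0, 1} : Finset ℝ),
      x ∈ (derivative^[l] (rodrigues n)).roots.toFinset := by
    intro l hl x hx
    rw [Multiset.mem_toFinset, mem_roots (iterate_derivative_rodrigues_ne_zero hl.le)]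
    simp only [Finset.mem_insert, Finset.mem_singleton] at hx
    rcases hx with rfl | rfl
    · exact eval_zero_iterate_derivative_rodrigues hl
    · exact eval_one_iterate_derivative_rodrigues hl
  induction k with
  | zero => simpa using Finset.card_le_card (hmem 0 hk)
  | succ k ih =>
    have h1 := card_roots_toFinset_le_card_roots_derivative_sdiff_roots_succ
      (derivative^[k] (rodrigues n))
    rw [← Function.iterate_succ_apply' (f := derivative)] at h1
    have h2 := ih (by omega)
    set A := (derivative^[k] (rodrigues n)).roots.toFinset
    set B := (derivative^[k + 1] (rodrigues n)).roots.toFinset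
    have h3 : (B \ A) ∪ {0, 1} ⊆ B := Finset.union_subset Finset.sdiff_subset (hmem _ hk)
    have h4 : Disjoint (B \ A) {0, 1} :=
      Finset.disjoint_sdiff.symm.mono_right (hmem k (by omega))
    have h5 := Finset.card_le_card h3
    rw [Finset.card_union_of_disjoint h4, Finset.card_pair zero_ne_one] at h5
    omega

theorem lobattoInterior_eq (m : ℕ) :
    lobattoInterior m = (derivative (legendreReal (m + 1))).roots.toFinset := by
  rw [lobattoInterior, jacobiPoly_eq_legendreDeriv, legendreDeriv, roots_C_mul _
    (inv_ne_zero (leadingCoeff_ne_zero.2 (derivative_legendreReal_ne_zero m)))]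

theorem natDegree_jacobiPoly (m : ℕ) : (jacobiPoly m).natDegree = m := by
  rw [jacobiPoly_eq_legendreDeriv, natDegree_legendreDeriv]

theorem monic_jacobiPoly (m : ℕ) : (jacobiPoly m).Monic := by
  rw [jacobiPoly_eq_legendreDeriv]; exact monic_legendreDeriv m

theorem jacobiPoly_orthogonal {m : ℕ} {q : ℝ[X]} (hq : q.degree < m) :
    polyIntegral (jacobiPoly m * q * weightPoly) = 0 := by
  rw [jacobiPoly_eq_legendreDeriv]; exact legendreDeriv_orthogonal hq

/-- The orthogonal polynomial of degree `m` has `m` distinct real zeros. -/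
theorem card_lobattoInterior (m : ℕ) : (lobattoInterior m).card = m := by
  apply le_antisymm
  · exact (Multiset.toFinset_card_le _).trans ((card_roots' _).trans (natDegree_jacobiPoly m).le)
  -- Two further applications of Rolle, from the `m`-th to the `(m + 2)`-nd derivative; the
  -- endpoints are now lost, so the count drops from `m + 2` to `m`.
  · have h1 := card_roots_iterate_derivative_rodrigues (Nat.lt_add_one m)
    have h2 := card_roots_toFinset_le_derivative (derivative^[m] (rodrigues (m + 1)))
    rw [← Function.iterate_succ_apply' (f := derivative), Nat.succ_eq_add_one,
      ← factorial_mul_legendreReal] at h2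
    have h3 := card_roots_toFinset_le_derivative
      (C ((m + 1).factorial : ℝ) * legendreReal (m + 1))
    rw [derivative_C_mul, roots_C_mul (derivative _)
      (Nat.cast_ne_zero.2 (Nat.factorial_ne_zero _)), ← lobattoInterior_eq] at h3
    omega

theorem eval_jacobiPoly_of_mem {m : ℕ} {x : ℝ} (hx : x ∈ lobattoInterior m) :
    (jacobiPoly m).eval x = 0 := by
  rw [lobattoInterior, Multiset.mem_toFinset, mem_roots (monic_jacobiPoly m).ne_zero] at hx
  exact hx

theorem jacobiPoly_eq_nodal (m : ℕ) : jacobiPoly m = Lagrange.nodal (lobattoInterior m) id := by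
  refine Polynomial.eq_of_degree_le_of_eval_index_eq (v := id) (lobattoInterior m)
    Function.injective_id.injOn ?_ ?_ ?_ fun x hx => ?_
  · rw [degree_eq_natDegree (monic_jacobiPoly m).ne_zero, natDegree_jacobiPoly,
      card_lobattoInterior]
  · rw [degree_eq_natDegree (monic_jacobiPoly m).ne_zero, natDegree_jacobiPoly,
      Lagrange.degree_nodal, card_lobattoInterior]
  · rw [(monic_jacobiPoly m).leadingCoeff, Lagrange.nodal_monic.leadingCoeff]
  · rw [Lagrange.eval_nodal_at_node hx, id, eval_jacobiPoly_of_mem hx]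

/-- The zeros of the orthogonal polynomials lie in the open interval. -/
theorem mem_Ioo_of_mem_lobattoInterior {m : ℕ} {a : ℝ} (ha : a ∈ lobattoInterior m) :
    a ∈ Ioo (0 : ℝ) 1 := by
  obtain ⟨g, hg⟩ := dvd_iff_isRoot.2 (eval_jacobiPoly_of_mem ha)
  have hg0 : g ≠ 0 := by
    rintro rfl
    exact (monic_jacobiPoly m).ne_zero (by rw [hg, mul_zero])
  have hdeg : g.degree < m := by
    have h := congrArg natDegree hg
    rw [natDegree_jacobiPoly, natDegree_mul (X_sub_C_ne_zero a) hg0, natDegree_X_sub_C] at h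
    exact (natDegree_lt_iff_degree_lt hg0).1 (by omega)
  -- Orthogonality to the cofactor `g` says that `(X - a) g² v` has integral zero. For `a` outside
  -- the open interval this polynomial has constant sign on `[0,1]`, which is a contradiction.
  have h0 := jacobiPoly_orthogonal hdeg
  rw [hg] at h0
  have hp : g * g * weightPoly ≠ 0 :=
    mul_ne_zero (mul_ne_zero hg0 hg0) weightPoly_ne_zero
  have hnn : ∀ x ∈ Icc (0 : ℝ) 1, 0 ≤ (g * g * weightPoly).eval x := fun x hx => by
    simp only [eval_mul, eval_weightPoly]
    exact mul_nonneg (mul_self_nonneg _) (jacobiWeight_nonneg hx)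
  constructor
  · by_contra! h
    refine (polyIntegral_pos (p := (X - C a) * g * g * weightPoly) ?_ fun x hx => ?_).ne' h0
    · rw [mul_assoc, mul_assoc, ← mul_assoc g]
      exact mul_ne_zero (X_sub_C_ne_zero a) hp
    · rw [mul_assoc, mul_assoc, ← mul_assoc g, eval_mul]
      refine mul_nonneg ?_ (hnn x hx)
      simp only [eval_sub, eval_X, eval_C]
      linarith [hx.1]
  · by_contra! h
    refine (polyIntegral_pos (p := -((X - C a) * g * g * weightPoly)) ?_ fun x hx => ?_).ne' ?_
    · rw [neg_ne_zero, mul_assoc, mul_assoc, ← mul_assoc g]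
      exact mul_ne_zero (X_sub_C_ne_zero a) hp
    · rw [mul_assoc, mul_assoc, ← mul_assoc g, eval_neg, eval_mul, ← neg_mul]
      refine mul_nonneg ?_ (hnn x hx)
      simp only [eval_sub, eval_X, eval_C]
      linarith [hx.2]
    · rw [map_neg, h0, neg_zero]

/-! ### The Lobatto rule -/

theorem lobattoCoeff_interior {m : ℕ} {a : ℝ} (ha : a ∈ lobattoInterior m) :
    lobattoCoeff m a = polyIntegral (Lagrange.basis (lobattoInterior m) id a * weightPoly) /
      jacobiWeight a := by
  have h := mem_Ioo_of_mem_lobattoInterior ha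
  rw [lobattoCoeff, if_neg (by rintro (rfl | rfl) <;> simp at h), intervalIntegral.integral_div]
  simp [polyIntegral_apply, eval_weightPoly]

/-- The fundamental polynomial `l` takes only the values `0` and `1` at the nodes, so `l² - l` is
divisible by the orthogonal polynomial with a quotient of degree below `m`. By orthogonality `∫ l v
= ∫ l² v > 0`. -/
theorem polyIntegral_basis_pos {m : ℕ} {a : ℝ} (ha : a ∈ lobattoInterior m) :
    0 < polyIntegral (Lagrange.basis (lobattoInterior m) id a * weightPoly) := by
  set l := Lagrange.basis (lobattoInterior m) id a with hl
  have hl0 : l ≠ 0 := Lagrange.basis_ne_zero Function.injective_id.injOn ha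
  have hdl : l.natDegree = m - 1 := by
    rw [hl, Lagrange.natDegree_basis Function.injective_id.injOn ha, card_lobattoInterior]
  have hm : 0 < m := by
    rw [← card_lobattoInterior m]; exact Finset.card_pos.2 ⟨a, ha⟩
  have hdvd : jacobiPoly m ∣ l * l - l := by
    rw [jacobiPoly_eq_nodal, Lagrange.nodal_eq]
    refine Finset.prod_dvd_of_coprime ?_ fun x hx => dvd_iff_isRoot.2 ?_
    · intro x _ y _ hxy
      exact isCoprime_X_sub_C_of_isUnit_sub (sub_ne_zero.2 hxy).isUnit
    · rcases eq_or_ne a x with rfl | hax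
      · have := Lagrange.eval_basis_self (v := id) Function.injective_id.injOn ha
        simp only [id] at this
        simp [hl, this]
      · have := Lagrange.eval_basis_of_ne (v := id) hax hx
        simp only [id] at this
        simp [hl, this]
  obtain ⟨g, hg⟩ := hdvd
  have hgd : g.degree < m := by
    rcases eq_or_ne g 0 with rfl | hg0
    · exact WithBot.bot_lt_coe m
    refine (natDegree_lt_iff_degree_lt hg0).1 ?_
    have h1 := congrArg natDegree hg
    rw [natDegree_mul (monic_jacobiPoly m).ne_zero hg0, natDegree_jacobiPoly] at h1
    have h2 := natDegree_sub_le (l * l) l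
    have h3 := natDegree_mul_le (p := l) (q := l)
    have : max (l * l).natDegree l.natDegree ≤ 2 * (m - 1) := by
      apply max_le <;> omega
    omega
  have h : l * weightPoly = l * l * weightPoly - jacobiPoly m * g * weightPoly := by
    rw [← hg]; ring
  rw [h, map_sub, jacobiPoly_orthogonal hgd, sub_zero]
  exact polyIntegral_sq_pos hl0

theorem lobattoCoeff_nonneg {m : ℕ} {x : ℝ} (hx : x ∈ lobattoNodes m) :
    0 ≤ lobattoCoeff m x := by
  by_cases h : x = 0 ∨ x = 1
  · rw [lobattoCoeff, if_pos h]; positivity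
  · rw [lobattoNodes, Finset.mem_insert, Finset.mem_insert, ← or_assoc] at hx
    have hx' := hx.resolve_left h
    rw [lobattoCoeff_interior hx']
    exact div_nonneg (polyIntegral_basis_pos hx').le
      (jacobiWeight_pos (mem_Ioo_of_mem_lobattoInterior hx')).le

theorem mem_Icc_of_mem_lobattoNodes {m : ℕ} {x : ℝ} (hx : x ∈ lobattoNodes m) :
    x ∈ Icc (0 : ℝ) 1 := by
  rw [lobattoNodes, Finset.mem_insert, Finset.mem_insert] at hx
  rcases hx with rfl | rfl | hx
  · simp
  · simp
  · exact Ioo_subset_Icc_self (mem_Ioo_of_mem_lobattoInterior hx)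

theorem lobattoSum_eq (m : ℕ) (f : ℝ → ℝ) :
    lobattoSum m f = 1 / (((m : ℝ) + 1) * ((m : ℝ) + 2)) * (f 0 + f 1) +
      ∑ x ∈ lobattoInterior m, lobattoCoeff m x * f x := by
  have h1 : (1 : ℝ) ∉ lobattoInterior m := fun h => by
    simpa using mem_Ioo_of_mem_lobattoInterior h
  have h0 : (0 : ℝ) ∉ insert 1 (lobattoInterior m) := fun h => by
    rcases Finset.mem_insert.1 h with h | h
    · exact zero_ne_one h
    · simpa using mem_Ioo_of_mem_lobattoInterior h
  rw [lobattoSum, lobattoNodes, Finset.sum_insert h0, Finset.sum_insert h1]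
  simp only [lobattoCoeff, true_or, or_true, if_true]
  ring

/-- The coefficients satisfy `λ_k v(x_k) = ∫ l_k v`, so on multiples of the weight the rule
integrates the Lagrange interpolant of `q`, which is `q` itself. -/
theorem sum_lobattoCoeff_mul_weight {m : ℕ} {q : ℝ[X]} (hq : q.degree < m) :
    ∑ x ∈ lobattoInterior m, lobattoCoeff m x * (q * weightPoly).eval x =
      polyIntegral (q * weightPoly) := by
  have h := Lagrange.eq_interpolate (s := lobattoInterior m) (v := id) Function.injective_id.injOn
    (f := q) (by rwa [card_lobattoInterior])
  conv_rhs => rw [h, Lagrange.interpolate_apply, Finset.sum_mul, map_sum]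
  refine Finset.sum_congr rfl fun x hx => ?_
  have hw := (jacobiWeight_pos (mem_Ioo_of_mem_lobattoInterior hx)).ne'
  rw [lobattoCoeff_interior hx, mul_assoc, C_mul', map_smul, smul_eq_mul, eval_mul,
    eval_weightPoly, id]
  field_simp

/-- The polynomial here vanishes at every node except `0`, so its integral determines the weight at
`0`; the next lemma plays this part for the node `1`. -/
theorem polyIntegral_one_sub_X_mul_derivative (m : ℕ) :
    polyIntegral ((1 - X) * derivative (legendreReal (m + 1))) = -1 := by
  have h := polyIntegral_legendreReal_mul (n := m + 1) (q := derivative (1 - X)) (by simp)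
  rw [mul_comm, polyIntegral_derivative_mul, h]
  simp [eval_zero_legendreReal]

theorem polyIntegral_X_mul_derivative (m : ℕ) :
    polyIntegral (X * derivative (legendreReal (m + 1))) = (-1) ^ (m + 1) := by
  have h := polyIntegral_legendreReal_mul (n := m + 1) (q := derivative X) (by simp)
  rw [mul_comm, polyIntegral_derivative_mul, h]
  simp [eval_one_legendreReal]

theorem eval_derivative_legendreReal_of_mem {m : ℕ} {x : ℝ} (hx : x ∈ lobattoInterior m) :
    (derivative (legendreReal (m + 1))).eval x = 0 := by
  rw [lobattoInterior_eq, Multiset.mem_toFinset,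
    mem_roots (derivative_legendreReal_ne_zero m)] at hx
  exact hx

/-- The Lobatto rule is exact on polynomials of degree at most `m + 1`. -/
theorem lobattoSum_eval {m : ℕ} {p : ℝ[X]} (hp : p.natDegree ≤ m + 1) :
    lobattoSum m (fun x => p.eval x) = polyIntegral p := by
  set P := derivative (legendreReal (m + 1)) with hP
  set N : ℝ := ((m : ℝ) + 1) * ((m : ℝ) + 2) with hN
  have hN0 : N ≠ 0 := by positivity
  have hP0 : P.eval 0 = -N := by
    rw [hP, eval_zero_derivative_legendreReal, hN]; push_cast; ring
  have hP1 : P.eval 1 = (-1) ^ (m + 1) * N := by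
    rw [hP, eval_one_derivative_legendreReal, hN]; push_cast; ring
  have hsgn : ((-1 : ℝ) ^ (m + 1)) * (-1) ^ (m + 1) = 1 := by
    rw [← mul_pow]; norm_num
  -- The corrections make `r` vanish at `0` and `1`, hence divisible by the weight. They vanish at
  -- the interior nodes, so they do not change the interior sum, and their integrals account for the
  -- two end terms.
  set r := p + (p.eval 0 / N) • ((1 - X) * P) - ((-1) ^ (m + 1) * p.eval 1 / N) • (X * P) with hr
  have hr0 : r.IsRoot 0 := by
    simp only [hr, IsRoot, eval_sub, eval_add, eval_smul, eval_mul, eval_one, eval_X, hP0,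
      smul_eq_mul]
    field_simp; ring
  have hr1 : r.IsRoot 1 := by
    simp only [hr, IsRoot, eval_sub, eval_add, eval_smul, eval_mul, eval_one, eval_X, hP1,
      smul_eq_mul]
    field_simp
    linear_combination (-(p.eval 1)) * hsgn
  have hdP : P.natDegree = m := by
    rw [hP, natDegree_derivative, natDegree_legendreReal, Nat.add_sub_cancel]
  have hrd : r.natDegree ≤ m + 1 := by
    have h1 : ((1 - X) * P : ℝ[X]).natDegree ≤ m + 1 := by
      refine natDegree_mul_le.trans ?_
      have : (1 - X : ℝ[X]).natDegree ≤ 1 := by compute_degree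
      omega
    have h2 : (X * P : ℝ[X]).natDegree ≤ m + 1 := by
      refine natDegree_mul_le.trans ?_
      rw [natDegree_X]
      omega
    have h3 := (natDegree_smul_le (p.eval 0 / N) ((1 - X) * P)).trans h1
    have h4 := (natDegree_smul_le ((-1) ^ (m + 1) * p.eval 1 / N) (X * P)).trans h2
    exact (natDegree_sub_le _ _).trans (max_le (natDegree_add_le_of_degree_le hp h3) h4)
  have hdvd : weightPoly ∣ r := by
    have h1 : (X : ℝ[X]) ∣ r := X_dvd_iff.2 (by rw [coeff_zero_eq_eval_zero]; exact hr0)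
    have h2 : (1 - X : ℝ[X]) ∣ r := by
      have := dvd_iff_isRoot.2 hr1
      rw [← neg_sub, neg_dvd]
      simpa using this
    refine IsCoprime.mul_dvd ⟨1, 1, by ring⟩ h1 h2
  obtain ⟨q, hq⟩ := hdvd
  have hqd : q.degree < m := by
    rcases eq_or_ne q 0 with rfl | hq0
    · exact WithBot.bot_lt_coe m
    refine (natDegree_lt_iff_degree_lt hq0).1 ?_
    have hw : weightPoly.natDegree = 2 := by
      rw [weightPoly, natDegree_mul X_ne_zero (by
        intro h; simpa using congrArg (Polynomial.eval 0) h), natDegree_X, ← neg_sub,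
        natDegree_neg]
      have := natDegree_X_sub_C (1 : ℝ)
      simp only [map_one] at this
      rw [this]
    rw [hq, natDegree_mul weightPoly_ne_zero hq0, hw] at hrd
    omega
  have hp' : p = q * weightPoly - (p.eval 0 / N) • ((1 - X) * P) +
      ((-1) ^ (m + 1) * p.eval 1 / N) • (X * P) := by
    rw [mul_comm q, ← hq, hr]; ring
  have hI : polyIntegral p = polyIntegral (q * weightPoly) + p.eval 0 / N + p.eval 1 / N := by
    conv_lhs => rw [hp']
    rw [map_add, map_sub, map_smul, map_smul, polyIntegral_one_sub_X_mul_derivative,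
      polyIntegral_X_mul_derivative, smul_eq_mul, smul_eq_mul]
    linear_combination (p.eval 1 / N) * hsgn
  rw [lobattoSum_eq, hI, ← sum_lobattoCoeff_mul_weight hqd, ← hN]
  have : ∀ x ∈ lobattoInterior m, lobattoCoeff m x * p.eval x =
      lobattoCoeff m x * (q * weightPoly).eval x := by
    intro x hx
    conv_lhs => rw [hp']
    simp [hP, eval_derivative_legendreReal_of_mem hx]
  rw [Finset.sum_congr rfl this]
  ring

theorem sum_lobattoCoeff (m : ℕ) : ∑ x ∈ lobattoNodes m, lobattoCoeff m x = 1 := by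
  have h := lobattoSum_eval (m := m) (p := 1) (by simp)
  simpa [lobattoSum, polyIntegral_apply] using h

/-! ### Quadrature and integration as continuous functionals -/

theorem valueAt_of_mem (f : C(Icc (0 : ℝ) 1, ℝ)) {t : ℝ} (h : t ∈ Icc (0 : ℝ) 1) :
    valueAt f t = f ⟨t, h⟩ :=
  IccExtend_of_mem _ _ h

theorem continuous_valueAt (f : C(Icc (0 : ℝ) 1, ℝ)) : Continuous (valueAt f) :=
  f.continuous.Icc_extend'

theorem abs_valueAt_le (f : C(Icc (0 : ℝ) 1, ℝ)) (t : ℝ) : |valueAt f t| ≤ ‖f‖ :=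
  f.norm_coe_le_norm _

/-- The Lobatto rule as a continuous linear functional. -/
noncomputable def lobattoCLM (m : ℕ) : C(Icc (0 : ℝ) 1, ℝ) →L[ℝ] ℝ :=
  LinearMap.mkContinuous
    { toFun := fun f => lobattoSum m (valueAt f)
      map_add' := fun f g => by
        simp only [lobattoSum, ← Finset.sum_add_distrib, ← mul_add]
        rfl
      map_smul' := fun c f => by
        simp only [lobattoSum, RingHom.id_apply, smul_eq_mul, Finset.mul_sum]
        refine Finset.sum_congr rfl fun x _ => ?_
        change _ * (c * _) = _
        rw [mul_left_comm]
        rfl } 1 fun f => by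
    refine (Finset.abs_sum_le_sum_abs _ _).trans ?_
    refine le_of_le_of_eq ?_ (congrArg (· * ‖f‖) (sum_lobattoCoeff m))
    simp only [Finset.sum_mul]
    refine Finset.sum_le_sum fun x hx => ?_
    rw [abs_mul, abs_of_nonneg (lobattoCoeff_nonneg hx)]
    exact mul_le_mul_of_nonneg_left (abs_valueAt_le f x) (lobattoCoeff_nonneg hx)

theorem lobattoCLM_apply (m : ℕ) (f : C(Icc (0 : ℝ) 1, ℝ)) :
    lobattoCLM m f = lobattoSum m (valueAt f) := rfl

theorem norm_lobattoCLM_le (m : ℕ) : ‖lobattoCLM m‖ ≤ 1 :=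
  LinearMap.mkContinuous_norm_le _ zero_le_one _

/-- The integral over `[0,1]` as a continuous linear functional. -/
noncomputable def integralCLM : C(Icc (0 : ℝ) 1, ℝ) →L[ℝ] ℝ :=
  LinearMap.mkContinuous
    { toFun := fun f => ∫ t in (0 : ℝ)..1, valueAt f t
      map_add' := fun f g => intervalIntegral.integral_add
        ((continuous_valueAt f).intervalIntegrable _ _)
        ((continuous_valueAt g).intervalIntegrable _ _)
      map_smul' := fun c f => intervalIntegral.integral_const_mul c (valueAt f) } 1 fun f => by
    have h := intervalIntegral.norm_integral_le_of_norm_le_const (a := 0) (b := 1)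
      (f := valueAt f) (C := ‖f‖) fun x _ => abs_valueAt_le f x
    rw [sub_zero, abs_one, mul_one] at h
    rwa [one_mul]

theorem integralCLM_apply (f : C(Icc (0 : ℝ) 1, ℝ)) :
    integralCLM f = ∫ t in (0 : ℝ)..1, valueAt f t := rfl

theorem norm_integralCLM_le : ‖integralCLM‖ ≤ 1 :=
  LinearMap.mkContinuous_norm_le _ zero_le_one _

theorem lobattoCLM_polynomial {m : ℕ} {p : ℝ[X]} (hp : p.natDegree ≤ m + 1) :
    lobattoCLM m (p.toContinuousMapOn _) = integralCLM (p.toContinuousMapOn _) := by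
  have h : ∀ t ∈ Icc (0 : ℝ) 1,
      valueAt (p.toContinuousMapOn (Icc 0 1)) t = p.eval t := fun t ht => by
    rw [valueAt_of_mem _ ht]; rfl
  have h1 : lobattoCLM m (p.toContinuousMapOn _) = lobattoSum m (fun x => p.eval x) :=
    Finset.sum_congr rfl fun x hx => by rw [h x (mem_Icc_of_mem_lobattoNodes hx)]
  rw [h1, lobattoSum_eval hp, integralCLM_apply, polyIntegral_apply]
  refine intervalIntegral.integral_congr fun t ht => ?_
  rw [uIcc_of_le zero_le_one] at ht
  exact (h t ht).symm

/-- The Lobatto rule converges for all continuous functions. -/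
theorem tendsto_lobattoCLM (f : C(Icc (0 : ℝ) 1, ℝ)) :
    Tendsto (fun m => lobattoCLM m f) atTop (𝓝 (integralCLM f)) := by
  rw [Metric.tendsto_atTop]
  intro ε hε
  obtain ⟨p, hp⟩ := exists_polynomial_near_continuousMap 0 1 f (ε / 2) (half_pos hε)
  refine ⟨p.natDegree, fun m hm => ?_⟩
  -- Rule and integral agree on `p`, so only the approximation error `p - f` is left, and each
  -- functional contributes less than `ε / 2`.
  have h1 : lobattoCLM m f - integralCLM f =
      integralCLM (p.toContinuousMapOn _ - f) - lobattoCLM m (p.toContinuousMapOn _ - f) := by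
    rw [map_sub, map_sub, lobattoCLM_polynomial (by omega)]; ring
  have h2 := (lobattoCLM m).le_of_opNorm_le (norm_lobattoCLM_le m) (p.toContinuousMapOn _ - f)
  have h3 := integralCLM.le_of_opNorm_le norm_integralCLM_le (p.toContinuousMapOn _ - f)
  rw [Real.dist_eq, h1, ← Real.norm_eq_abs]
  refine (norm_sub_le _ _).trans_lt ?_
  linarith

/-! ### Integral operators with continuous kernels -/

/-- Arzelà-Ascoli for the functions with a common bound and a common modulus of continuity. -/
theorem isCompact_of_modulus {X : Type*} [TopologicalSpace X] (B : ℝ) (ω : X → X → ℝ)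
    (hω : ∀ s, Tendsto (ω s) (𝓝 s) (𝓝 0)) :
    IsCompact {g : C(X, ℝ) | ∀ s, |g s| ≤ B ∧ ∀ s', |g s - g s'| ≤ ω s s'} := by
  apply ArzelaAscoli.isCompact_of_equicontinuous
  -- Compactness is checked in the product topology. The common modulus forces continuity, so the
  -- set of functions is a box cut by closed pointwise conditions.
  · have himg : ContinuousMap.toFun '' {g : C(X, ℝ) | ∀ s, |g s| ≤ B ∧ ∀ s', |g s - g s'| ≤ ω s s'}
        = (univ.pi fun _ => Icc (-B) B) ∩ {h : X → ℝ | ∀ s s', |h s - h s'| ≤ ω s s'} := by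
      ext h
      constructor
      · rintro ⟨g, hg, rfl⟩
        exact ⟨fun s _ => abs_le.1 (hg s).1, fun s => (hg s).2⟩
      · rintro ⟨h1, h2⟩
        have hc : Continuous h := continuous_iff_continuousAt.2 fun s => by
          rw [ContinuousAt, tendsto_iff_dist_tendsto_zero]
          refine squeeze_zero (fun _ => dist_nonneg) (fun s' => ?_) (hω s)
          rw [dist_comm]
          exact h2 s s'
        exact ⟨⟨h, hc⟩, fun s => ⟨abs_le.2 (h1 s trivial), h2 s⟩, rfl⟩
    rw [himg]
    refine (isCompact_univ_pi fun _ => isCompact_Icc).inter_right ?_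
    simp only [ofPred_forall]
    refine isClosed_iInter fun s => isClosed_iInter fun s' => isClosed_le ?_ continuous_const
    exact ((continuous_apply s).sub (continuous_apply s')).abs
  · intro s
    rw [Metric.equicontinuousAt_iff_right]
    intro ε hε
    filter_upwards [(hω s).eventually_lt_const hε] with s' hs' g
    exact ((g.2 s).2 s').trans_lt hs'

section KernelOperators

variable {X Y : Type*} [TopologicalSpace X] [CompactSpace X] [TopologicalSpace Y] [CompactSpace Y]

/-- The operator `f ↦ (s ↦ A (κ s · f))` attached to a continuous kernel `κ` and a continuous
functional `A`. -/
noncomputable def kernelOp (κ : C(X, C(Y, ℝ))) (A : C(Y, ℝ) →L[ℝ] ℝ) : C(Y, ℝ) →L[ℝ] C(X, ℝ) :=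
  LinearMap.mkContinuous
    { toFun := fun f => ⟨fun s => A (κ s * f),
        A.continuous.comp (κ.continuous.mul continuous_const)⟩
      map_add' := fun f g => by
        ext s
        change A (κ s * (f + g)) = A (κ s * f) + A (κ s * g)
        rw [mul_add, map_add]
      map_smul' := fun c f => by
        ext s
        change A (κ s * (c • f)) = c • A (κ s * f)
        rw [mul_smul_comm, map_smul] } (‖A‖ * ‖κ‖) fun f => by
    refine (ContinuousMap.norm_le _ (by positivity)).2 fun s => ?_
    refine (A.le_opNorm _).trans ?_
    rw [mul_assoc]
    refine mul_le_mul_of_nonneg_left ?_ (norm_nonneg _)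
    exact (norm_mul_le _ _).trans
      (mul_le_mul_of_nonneg_right (κ.norm_coe_le_norm s) (norm_nonneg _))

theorem kernelOp_apply (κ : C(X, C(Y, ℝ))) (A : C(Y, ℝ) →L[ℝ] ℝ) (f : C(Y, ℝ)) (s : X) :
    kernelOp κ A f s = A (κ s * f) := rfl

/-- The modulus of continuity does not depend on the functional `A`; this uniformity in `m` drives
both compactness and convergence. -/
theorem abs_kernelOp_sub_le {κ : C(X, C(Y, ℝ))} {A : C(Y, ℝ) →L[ℝ] ℝ} (hA : ‖A‖ ≤ 1)
    (f : C(Y, ℝ)) (s s' : X) :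
    |kernelOp κ A f s - kernelOp κ A f s'| ≤ ‖κ s - κ s'‖ * ‖f‖ := by
  rw [kernelOp_apply, kernelOp_apply, ← map_sub, ← sub_mul]
  refine (A.le_of_opNorm_le hA _).trans ?_
  rw [one_mul]
  exact norm_mul_le _ _

theorem abs_kernelOp_le {κ : C(X, C(Y, ℝ))} {A : C(Y, ℝ) →L[ℝ] ℝ} (hA : ‖A‖ ≤ 1)
    (f : C(Y, ℝ)) (s : X) : |kernelOp κ A f s| ≤ ‖κ‖ * ‖f‖ := by
  rw [kernelOp_apply]
  refine (A.le_of_opNorm_le hA _).trans ?_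
  rw [one_mul]
  exact (norm_mul_le _ _).trans
    (mul_le_mul_of_nonneg_right (κ.norm_coe_le_norm s) (norm_nonneg _))

/-- Pointwise convergence of functionals of norm at most one implies strong convergence of the
associated operators. -/
theorem tendsto_kernelOp (κ : C(X, C(Y, ℝ))) {A : ℕ → C(Y, ℝ) →L[ℝ] ℝ}
    {A' : C(Y, ℝ) →L[ℝ] ℝ} (hA : ∀ m, ‖A m‖ ≤ 1)
    (h : ∀ f, Tendsto (fun m => A m f) atTop (𝓝 (A' f))) (f : C(Y, ℝ)) :
    Tendsto (fun m => kernelOp κ (A m) f) atTop (𝓝 (kernelOp κ A' f)) := by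
  have heq : Equicontinuous fun m => ⇑(kernelOp κ (A m) f) := by
    intro s
    rw [Metric.equicontinuousAt_iff_right]
    intro ε hε
    have hc : Tendsto (fun s' => ‖κ s - κ s'‖ * ‖f‖) (𝓝 s) (𝓝 0) := by
      have : Continuous fun s' => ‖κ s - κ s'‖ * ‖f‖ :=
        ((continuous_const.sub κ.continuous).norm).mul continuous_const
      simpa using this.tendsto s
    filter_upwards [hc.eventually_lt_const hε] with s' hs' m
    exact (abs_kernelOp_sub_le (hA m) f s s').trans_lt hs'
  have hpt : Tendsto (fun m => ⇑(kernelOp κ (A m) f)) atTop (𝓝 ⇑(kernelOp κ A' f)) :=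
    tendsto_pi_nhds.2 fun s => h _
  -- On a compact space, pointwise and uniform convergence coincide for an equicontinuous family.
  rw [ContinuousMap.tendsto_iff_tendstoUniformly]
  exact UniformFun.tendsto_iff_tendstoUniformly.1
    ((heq.tendsto_uniformFun_iff_pi atTop _).2 hpt)

end KernelOperators

/-! ### Block operators on the space `𝒳` -/

/-- The matrix operator with the continuous kernels `κ i j`. -/
noncomputable def blockOp (κ : Fin 3 → Fin 3 → C(Icc (0 : ℝ) 1, C(Icc (0 : ℝ) 1, ℝ)))
    (A : C(Icc (0 : ℝ) 1, ℝ) →L[ℝ] ℝ) : TripleC →L[ℝ] TripleC :=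
  ContinuousLinearMap.pi fun i => ∑ j, (kernelOp (κ i j) A).comp (ContinuousLinearMap.proj j)

theorem blockOp_apply (κ : Fin 3 → Fin 3 → C(Icc (0 : ℝ) 1, C(Icc (0 : ℝ) 1, ℝ)))
    (A : C(Icc (0 : ℝ) 1, ℝ) →L[ℝ] ℝ) (ρ : TripleC) (i : Fin 3) :
    blockOp κ A ρ i = ∑ j, kernelOp (κ i j) A (ρ j) := by
  simp [blockOp]

theorem blockOp_apply_apply (κ : Fin 3 → Fin 3 → C(Icc (0 : ℝ) 1, C(Icc (0 : ℝ) 1, ℝ)))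
    (A : C(Icc (0 : ℝ) 1, ℝ) →L[ℝ] ℝ) (ρ : TripleC) (i : Fin 3) (s : Icc (0 : ℝ) 1) :
    blockOp κ A ρ i s = ∑ j, A (κ i j s * ρ j) := by
  simp [blockOp_apply, kernelOp_apply]

theorem mem_spaceX_iff {f : TripleC} :
    f ∈ spaceX ↔ f 0 ⟨0, left_mem_Icc.2 zero_le_one⟩ = f 1 ⟨0, left_mem_Icc.2 zero_le_one⟩ := by
  change valueAt (f 0) 0 = valueAt (f 1) 0 ↔ _
  rw [valueAt_of_mem, valueAt_of_mem]

/-- The restriction of a block operator to `𝒳`. -/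
noncomputable def blockOpX (κ : Fin 3 → Fin 3 → C(Icc (0 : ℝ) 1, C(Icc (0 : ℝ) 1, ℝ)))
    (hκ : ∀ j, κ 0 j ⟨0, left_mem_Icc.2 zero_le_one⟩ = κ 1 j ⟨0, left_mem_Icc.2 zero_le_one⟩)
    (A : C(Icc (0 : ℝ) 1, ℝ) →L[ℝ] ℝ) : spaceX →L[ℝ] spaceX :=
  ((blockOp κ A).comp spaceX.subtypeL).codRestrict spaceX fun ρ => by
    rw [mem_spaceX_iff, ContinuousLinearMap.comp_apply, blockOp_apply_apply, blockOp_apply_apply]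
    simp only [hκ]

theorem coe_blockOpX (κ : Fin 3 → Fin 3 → C(Icc (0 : ℝ) 1, C(Icc (0 : ℝ) 1, ℝ)))
    (hκ : ∀ j, κ 0 j ⟨0, left_mem_Icc.2 zero_le_one⟩ = κ 1 j ⟨0, left_mem_Icc.2 zero_le_one⟩)
    (A : C(Icc (0 : ℝ) 1, ℝ) →L[ℝ] ℝ) (ρ : spaceX) :
    (blockOpX κ hκ A ρ : TripleC) = blockOp κ A ρ := rfl

theorem isClosed_spaceX : IsClosed (spaceX : Set TripleC) := by
  have : (spaceX : Set TripleC) = {f | f 0 ⟨0, left_mem_Icc.2 zero_le_one⟩ =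
      f 1 ⟨0, left_mem_Icc.2 zero_le_one⟩} := by
    ext f; exact mem_spaceX_iff
  rw [this]
  exact isClosed_eq ((continuous_eval_const _).comp (continuous_apply 0))
    ((continuous_eval_const _).comp (continuous_apply 1))

/-- The bound and the modulus involve only the kernels and the radius `R` of `U`, so a single
Arzelà-Ascoli set contains the images under all operators. -/
theorem collectivelyCompact_blockOpX
    (κ : Fin 3 → Fin 3 → C(Icc (0 : ℝ) 1, C(Icc (0 : ℝ) 1, ℝ)))
    (hκ : ∀ j, κ 0 j ⟨0, left_mem_Icc.2 zero_le_one⟩ = κ 1 j ⟨0, left_mem_Icc.2 zero_le_one⟩)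
    {A : ℕ → C(Icc (0 : ℝ) 1, ℝ) →L[ℝ] ℝ} (hA : ∀ m, ‖A m‖ ≤ 1) :
    CollectivelyCompact (E := spaceX) (F := spaceX) (range fun m => blockOpX κ hκ (A m)) := by
  intro U hU
  obtain ⟨R, hR⟩ := hU.exists_norm_le
  let ω : Fin 3 → Icc (0 : ℝ) 1 → Icc (0 : ℝ) 1 → ℝ := fun i s s' =>
    ∑ j, ‖κ i j s - κ i j s'‖ * R
  have hω : ∀ i s, Tendsto (ω i s) (𝓝 s) (𝓝 0) := fun i s => by
    have hc : Continuous (ω i s) := continuous_finsetSum _ fun j _ =>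
      ((continuous_const.sub (κ i j).continuous).norm).mul continuous_const
    simpa [ω] using hc.tendsto s
  let K : Set TripleC := univ.pi fun i =>
    {g | ∀ s, |g s| ≤ ∑ j, ‖κ i j‖ * R ∧ ∀ s', |g s - g s'| ≤ ω i s s'}
  have hK : IsCompact K := isCompact_univ_pi fun i => isCompact_of_modulus _ _ (hω i)
  -- Since `𝒳` is closed in the space of triples, compactness of `K` passes to its trace on `𝒳`.
  refine (isClosed_spaceX.isClosedEmbedding_subtypeVal.isCompact_preimage hK).closure_of_subset ?_
  rintro _ ⟨_, ⟨m, rfl⟩, ρ, hρ, rfl⟩ i -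
  have hnorm : ∀ j, ‖(ρ : TripleC) j‖ ≤ R := fun j =>
    (norm_le_pi_norm (ρ : TripleC) j).trans (hR ρ hρ)
  intro s
  simp only [coe_blockOpX, blockOp_apply, ContinuousMap.sum_apply]
  refine ⟨(Finset.abs_sum_le_sum_abs _ _).trans (Finset.sum_le_sum fun j _ => ?_), fun s' => ?_⟩
  · exact (abs_kernelOp_le (hA m) _ _).trans
      (mul_le_mul_of_nonneg_left (hnorm j) (norm_nonneg (κ i j)))
  · rw [← Finset.sum_sub_distrib]
    refine (Finset.abs_sum_le_sum_abs _ _).trans (Finset.sum_le_sum fun j _ => ?_)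
    exact (abs_kernelOp_sub_le (hA m) _ _ _).trans
      (mul_le_mul_of_nonneg_left (hnorm j) (norm_nonneg _))

theorem tendsto_norm_blockOpX_sub
    (κ : Fin 3 → Fin 3 → C(Icc (0 : ℝ) 1, C(Icc (0 : ℝ) 1, ℝ)))
    (hκ : ∀ j, κ 0 j ⟨0, left_mem_Icc.2 zero_le_one⟩ = κ 1 j ⟨0, left_mem_Icc.2 zero_le_one⟩)
    {A : ℕ → C(Icc (0 : ℝ) 1, ℝ) →L[ℝ] ℝ} {A' : C(Icc (0 : ℝ) 1, ℝ) →L[ℝ] ℝ}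
    (hA : ∀ m, ‖A m‖ ≤ 1) (h : ∀ f, Tendsto (fun m => A m f) atTop (𝓝 (A' f))) (ρ : spaceX) :
    Tendsto (fun m => ‖blockOpX κ hκ (A m) ρ - blockOpX κ hκ A' ρ‖) atTop (𝓝 0) := by
  refine tendsto_iff_norm_sub_tendsto_zero.1 ?_
  rw [tendsto_subtype_rng, tendsto_pi_nhds]
  intro i
  simp only [coe_blockOpX, blockOp_apply]
  exact tendsto_finsetSum _ fun j _ => tendsto_kernelOp _ hA h _

/-! ### Taylor expansions of plane curves of class `C²` -/

/-- The planeCross product of two plane vectors. -/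
noncomputable def planeCross (a b : ℂ) : ℝ := a.re * b.im - a.im * b.re

theorem planeCross_add_right (a b c : ℂ) :
    planeCross a (b + c) = planeCross a b + planeCross a c := by
  simp only [planeCross, Complex.add_re, Complex.add_im]; ring

theorem planeCross_ofReal_mul_right (a b : ℂ) (r : ℝ) :
    planeCross a (r * b) = r * planeCross a b := by
  simp [planeCross]; ring

theorem planeCross_ofReal_mul_left (a b : ℂ) (r : ℝ) :
    planeCross (r * a) b = r * planeCross a b := by
  simp [planeCross]; ring

theorem planeCross_self (a : ℂ) : planeCross a a = 0 := by
  simp only [planeCross]; ring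

theorem continuous_planeCross : Continuous fun p : ℂ × ℂ => planeCross p.1 p.2 := by
  unfold planeCross
  have h1 := Complex.continuous_re.comp (continuous_fst (X := ℂ) (Y := ℂ))
  have h2 := Complex.continuous_im.comp (continuous_snd (X := ℂ) (Y := ℂ))
  have h3 := Complex.continuous_im.comp (continuous_fst (X := ℂ) (Y := ℂ))
  have h4 := Complex.continuous_re.comp (continuous_snd (X := ℂ) (Y := ℂ))
  exact (h1.mul h2).sub (h3.mul h4)

theorem Filter.Tendsto.planeCross {ι : Type*} {l : Filter ι} {f g : ι → ℂ} {a b : ℂ}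
    (hf : Tendsto f l (𝓝 a)) (hg : Tendsto g l (𝓝 b)) :
    Tendsto (fun i => _root_.planeCross (f i) (g i)) l (𝓝 (_root_.planeCross a b)) :=
  (continuous_planeCross.tendsto (a, b)).comp (hf.prodMk_nhds hg)

/-- The mean value of `f` on the segment from `t` to `s`. -/
noncomputable def segmentMean (f : ℝ → ℂ) (p : ℝ × ℝ) : ℂ :=
  ∫ u in (0 : ℝ)..1, f (p.1 + u * (p.2 - p.1))

/-- The weighted mean of `f` in the second order remainder of Taylor's formula. -/
noncomputable def segmentRemainder (f : ℝ → ℂ) (p : ℝ × ℝ) : ℂ :=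
  ∫ u in (0 : ℝ)..1, ((1 - u : ℝ) : ℂ) * f (p.1 + u * (p.2 - p.1))

theorem continuous_segmentMean {f : ℝ → ℂ} (hf : Continuous f) :
    Continuous (segmentMean f) :=
  intervalIntegral.continuous_parametric_intervalIntegral_of_continuous' (by fun_prop) 0 1

theorem continuous_segmentRemainder {f : ℝ → ℂ} (hf : Continuous f) :
    Continuous (segmentRemainder f) :=
  intervalIntegral.continuous_parametric_intervalIntegral_of_continuous' (by fun_prop) 0 1

theorem segmentMean_self (f : ℝ → ℂ) (t : ℝ) : segmentMean f (t, t) = f t := by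
  simp [segmentMean]

theorem segmentRemainder_self (f : ℝ → ℂ) (t : ℝ) : segmentRemainder f (t, t) = f t / 2 := by
  have h : ∫ u in (0 : ℝ)..1, ((1 - u : ℝ) : ℂ) = 1 / 2 := by
    rw [intervalIntegral.integral_ofReal, intervalIntegral.integral_sub (by simp) (by simp)]
    simp
    norm_num
  simp only [segmentRemainder, sub_self, mul_zero, add_zero]
  rw [intervalIntegral.integral_mul_const, h]
  ring

theorem sub_eq_mul_segmentMean {f f' : ℝ → ℂ} (hf : ∀ x, HasDerivAt f (f' x) x)
    (hf' : Continuous f') (t s : ℝ) :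
    f s - f t = ((s - t : ℝ) : ℂ) * segmentMean f' (t, s) := by
  have hd : ∀ u : ℝ, HasDerivAt (fun u : ℝ => f (t + u * (s - t)))
      (((s - t : ℝ) : ℂ) * f' (t + u * (s - t))) u := fun u => by
    have h1 : HasDerivAt (fun u : ℝ => t + u * (s - t)) (s - t) u := by
      simpa using ((hasDerivAt_id u).mul_const (s - t)).const_add t
    simpa [Function.comp_def] using (hf (t + u * (s - t))).scomp u h1
  have h := intervalIntegral.integral_eq_sub_of_hasDerivAt (a := 0) (b := 1) (fun u _ => hd u)
    ((by fun_prop : Continuous fun u : ℝ => ((s - t : ℝ) : ℂ) *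
      f' (t + u * (s - t))).intervalIntegrable _ _)
  rw [intervalIntegral.integral_const_mul] at h
  simpa [segmentMean] using h.symm

/-- The integral form is chosen because the remainder is jointly continuous in `(t, s)`, the
diagonal included. -/
theorem sub_eq_taylor_segmentRemainder {f f' f'' : ℝ → ℂ} (hf : ∀ x, HasDerivAt f (f' x) x)
    (hf' : ∀ x, HasDerivAt f' (f'' x) x) (hf'' : Continuous f'') (t s : ℝ) :
    f s - f t = ((s - t : ℝ) : ℂ) * f' t +
      (((s - t) ^ 2 : ℝ) : ℂ) * segmentRemainder f'' (t, s) := by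
  have hd : ∀ u : ℝ, HasDerivAt (fun u : ℝ => f (t + u * (s - t)) +
      (((1 - u) * (s - t) : ℝ) : ℂ) * f' (t + u * (s - t)))
      ((((s - t) ^ 2 : ℝ) : ℂ) * (((1 - u : ℝ) : ℂ) * f'' (t + u * (s - t)))) u := fun u => by
    have h1 : HasDerivAt (fun u : ℝ => t + u * (s - t)) (s - t) u := by
      simpa using ((hasDerivAt_id u).mul_const (s - t)).const_add t
    have h2 := (hf (t + u * (s - t))).scomp u h1
    have h3 := (hf' (t + u * (s - t))).scomp u h1
    have h4 : HasDerivAt (fun u : ℝ => (((1 - u) * (s - t) : ℝ) : ℂ)) ((-(s - t) : ℝ) : ℂ) u := by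
      have h5 : HasDerivAt (fun u : ℝ => (1 - u) * (s - t)) (-(s - t)) u := by
        simpa using ((hasDerivAt_id u).const_sub 1).mul_const (s - t)
      exact h5.ofReal_comp
    refine (h2.add (h4.mul h3)).congr_deriv ?_
    simp only [Function.comp_apply, Complex.real_smul]
    push_cast
    ring
  have h := intervalIntegral.integral_eq_sub_of_hasDerivAt (a := 0) (b := 1) (fun u _ => hd u)
    ((by fun_prop : Continuous fun u : ℝ => (((s - t) ^ 2 : ℝ) : ℂ) * (((1 - u : ℝ) : ℂ) *
      f'' (t + u * (s - t)))).intervalIntegrable _ _)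
  rw [intervalIntegral.integral_const_mul] at h
  simp only [one_mul, sub_self, zero_mul, Complex.ofReal_zero, add_zero, sub_zero,
    add_sub_cancel] at h
  rw [segmentRemainder, h]
  ring

/-- A curve of class `C²` on the whole line, with its first and second derivative. -/
structure IsC2Curve (f f' f'' : ℝ → ℂ) : Prop where
  hasDerivAt : ∀ x, HasDerivAt f (f' x) x
  hasDerivAt' : ∀ x, HasDerivAt f' (f'' x) x
  continuous'' : Continuous f''

namespace IsC2Curve

variable {f f' f'' : ℝ → ℂ} (h : IsC2Curve f f' f'')
include h

theorem continuous' : Continuous f' :=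
  continuous_iff_continuousAt.2 fun x => (h.hasDerivAt' x).continuousAt

end IsC2Curve

theorem hasDerivWithinAt_arcD1 {σ : ℝ → ℂ} (h : ContDiffOn ℝ 2 σ (Icc 0 1)) {t : ℝ}
    (ht : t ∈ Icc (0 : ℝ) 1) : HasDerivWithinAt σ (arcD1 σ t) (Icc 0 1) t :=
  (h.differentiableOn (by norm_num) t ht).hasDerivWithinAt

theorem contDiffOn_arcD1 {σ : ℝ → ℂ} (h : ContDiffOn ℝ 2 σ (Icc 0 1)) :
    ContDiffOn ℝ 1 (arcD1 σ) (Icc 0 1) :=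
  h.derivWithin (uniqueDiffOn_Icc zero_lt_one) (by norm_num)

theorem hasDerivWithinAt_arcD2 {σ : ℝ → ℂ} (h : ContDiffOn ℝ 2 σ (Icc 0 1)) {t : ℝ}
    (ht : t ∈ Icc (0 : ℝ) 1) : HasDerivWithinAt (arcD1 σ) (arcD2 σ t) (Icc 0 1) t :=
  ((contDiffOn_arcD1 h).differentiableOn (by norm_num) t ht).hasDerivWithinAt

theorem continuousOn_arcD2 {σ : ℝ → ℂ} (h : ContDiffOn ℝ 2 σ (Icc 0 1)) :
    ContinuousOn (arcD2 σ) (Icc 0 1) :=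
  (contDiffOn_arcD1 h).continuousOn_derivWithin (uniqueDiffOn_Icc zero_lt_one) (by norm_num)

/-- A function on `[0,1]` is the integral of its derivative. -/
theorem eq_add_integral_of_hasDerivWithinAt {f f' g : ℝ → ℂ}
    (hf : ∀ t ∈ Icc (0 : ℝ) 1, HasDerivWithinAt f (f' t) (Icc 0 1) t) (hg : Continuous g)
    (hfg : EqOn f' g (Icc 0 1)) {x : ℝ} (hx : x ∈ Icc (0 : ℝ) 1) :
    f x = f 0 + ∫ u in (0 : ℝ)..x, g u := by
  have h := intervalIntegral.integral_eq_sub_of_hasDerivAt_of_le hx.1 (f := f) (f' := g)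
    (fun t ht => ((hf t ⟨ht.1, ht.2.trans hx.2⟩).continuousWithinAt).mono
      (Icc_subset_Icc_right hx.2)) (fun t ht => ?_) (hg.intervalIntegrable _ _)
  · rw [h]; ring
  · have ht' : t ∈ Ioo (0 : ℝ) 1 := ⟨ht.1, ht.2.trans_le hx.2⟩
    rw [← hfg (Ioo_subset_Icc_self ht')]
    exact (hf t (Ioo_subset_Icc_self ht')).hasDerivAt (Icc_mem_nhds ht'.1 ht'.2)

/-- An arc of class `C²` on `[0,1]` extends to a curve of class `C²` on the line. -/
theorem exists_isC2Curve {σ : ℝ → ℂ} (h : ContDiffOn ℝ 2 σ (Icc 0 1)) :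
    ∃ f f' f'' : ℝ → ℂ, IsC2Curve f f' f'' ∧ EqOn σ f (Icc 0 1) ∧
      EqOn (arcD1 σ) f' (Icc 0 1) ∧ EqOn (arcD2 σ) f'' (Icc 0 1) := by
  -- The second derivative is extended by its end values and integrated twice.
  set f'' : ℝ → ℂ := IccExtend zero_le_one ((Icc (0 : ℝ) 1).domRestrict (arcD2 σ)) with hf''
  have hc'' : Continuous f'' :=
    (continuousOn_iff_continuous_domRestrict.1 (continuousOn_arcD2 h)).Icc_extend'
  have he'' : EqOn (arcD2 σ) f'' (Icc 0 1) := fun x hx => by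
    rw [hf'', IccExtend_of_mem _ _ hx]; rfl
  set f' : ℝ → ℂ := fun x => arcD1 σ 0 + ∫ u in (0 : ℝ)..x, f'' u with hf'
  have hd' : ∀ x, HasDerivAt f' (f'' x) x := fun x =>
    (intervalIntegral.integral_hasDerivAt_right (hc''.intervalIntegrable _ _)
      (hc''.stronglyMeasurableAtFilter _ _) hc''.continuousAt).const_add _
  have he' : EqOn (arcD1 σ) f' (Icc 0 1) := fun x hx =>
    eq_add_integral_of_hasDerivWithinAt (fun t ht => hasDerivWithinAt_arcD2 h ht) hc'' he'' hx
  have hc' : Continuous f' :=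
    continuous_iff_continuousAt.2 fun x => (hd' x).continuousAt
  refine ⟨fun x => σ 0 + ∫ u in (0 : ℝ)..x, f' u, f', f'', ⟨fun x => ?_, hd', hc''⟩, ?_, he', he''⟩
  · exact (intervalIntegral.integral_hasDerivAt_right (hc'.intervalIntegrable _ _)
      (hc'.stronglyMeasurableAtFilter _ _) hc'.continuousAt).const_add _
  · exact fun x hx =>
      eq_add_integral_of_hasDerivWithinAt (fun t ht => hasDerivWithinAt_arcD1 h ht) hc' he' hx

/-! ### The double layer kernel of two curves -/

namespace IsC2Curve

/-- The double layer kernel of a regular simple arc extends continuously to the diagonal. -/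
theorem continuousOn_planeCross_div {f f' f'' : ℝ → ℂ} (h : IsC2Curve f f' f'') {S : Set ℝ}
    (hinj : InjOn f S) (hreg : ∀ t ∈ S, f' t ≠ 0) :
    ContinuousOn (fun p : ℝ × ℝ => if f p.2 = f p.1 then
        planeCross (f' p.1) (f'' p.1) / (2 * Complex.normSq (f' p.1))
      else planeCross (f' p.1) (f p.2 - f p.1) / Complex.normSq (f p.2 - f p.1)) (S ×ˢ S) := by
  have hq : ∀ p ∈ S ×ˢ S, segmentMean f' p ≠ 0 := by
    rintro ⟨t, s⟩ ⟨ht, hs⟩ h0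
    rcases eq_or_ne t s with rfl | hne
    · rw [segmentMean_self] at h0
      exact hreg t ht h0
    · have h1 := sub_eq_mul_segmentMean h.hasDerivAt h.continuous' t s
      rw [h0, mul_zero, sub_eq_zero] at h1
      exact hne (hinj hs ht h1).symm
  -- This is the kernel after cancelling `(s - t)²`: the cross product with `f' t` kills the linear
  -- Taylor term of the numerator. On the diagonal the remainder equals `f'' / 2`, which gives the
  -- curvature term.
  have hcont : ContinuousOn (fun p : ℝ × ℝ => planeCross (f' p.1) (segmentRemainder f'' p) /
      Complex.normSq (segmentMean f' p)) (S ×ˢ S) := by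
    refine ContinuousOn.div ?_ ?_ fun p hp => ?_
    · exact (continuous_planeCross.comp ((h.continuous'.comp continuous_fst).prodMk
        (continuous_segmentRemainder h.continuous''))).continuousOn
    · exact (Complex.continuous_normSq.comp (continuous_segmentMean h.continuous')).continuousOn
    · exact (map_ne_zero Complex.normSq).2 (hq p hp)
  refine hcont.congr ?_
  rintro ⟨t, s⟩ ⟨ht, hs⟩
  dsimp only at ht hs ⊢
  split_ifs with heq
  · obtain rfl := hinj hs ht heq
    rw [segmentMean_self, segmentRemainder_self, div_eq_inv_mul (f'' s),
      show (2 : ℂ)⁻¹ = ((2⁻¹ : ℝ) : ℂ) by push_cast; rfl, planeCross_ofReal_mul_right]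
    have := (map_ne_zero Complex.normSq).2 (hreg s hs)
    field_simp
  · have hne : s - t ≠ 0 := fun h0 => heq (by rw [sub_eq_zero.1 h0])
    conv_lhs =>
      -- The second-order expansion is undone in the denominator, where the first-order form is the
      -- useful one.
      rw [sub_eq_taylor_segmentRemainder h.hasDerivAt h.hasDerivAt' h.continuous'',
        planeCross_add_right, planeCross_ofReal_mul_right, planeCross_self, mul_zero, zero_add,
        planeCross_ofReal_mul_right, ← sub_eq_taylor_segmentRemainder h.hasDerivAt h.hasDerivAt'
        h.continuous'', sub_eq_mul_segmentMean h.hasDerivAt h.continuous', map_mul,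
        Complex.normSq_ofReal, ← pow_two]
    exact mul_div_mul_left _ _ (pow_ne_zero 2 hne)

theorem tendsto_segmentRemainder {f f' f'' : ℝ → ℂ} (h : IsC2Curve f f' f'') (t : ℝ) :
    Tendsto (fun s => segmentRemainder f'' (t, s)) (𝓝 t) (𝓝 (f'' t / 2)) := by
  have := ((continuous_segmentRemainder h.continuous'').comp
    (Continuous.prodMk_right t)).tendsto t
  simpa [Function.comp_def, segmentRemainder_self] using this

theorem tendsto_segmentMean {f f' f'' : ℝ → ℂ} (h : IsC2Curve f f' f'') (t : ℝ) :
    Tendsto (fun s => segmentMean f'' (t, s)) (𝓝 t) (𝓝 (f'' t)) := by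
  have := ((continuous_segmentMean h.continuous'').comp
    (Continuous.prodMk_right t)).tendsto t
  simpa [Function.comp_def, segmentMean_self] using this

/-- At a common point of two curves, where they have the same tangent line and the same
curvature, the double layer kernel tends to the curvature term, provided the point on the first
curve and the point on the second one lie on different sides of the common point. -/
theorem tendsto_planeCross_div {a a' a'' b b' b'' : ℝ → ℂ} (ha : IsC2Curve a a' a'')
    (hb : IsC2Curve b b' b'') {s₀ t₀ c : ℝ} (hc : c ≠ 0) (hab : a s₀ = b t₀)
    (hab' : a' s₀ = c * b' t₀) (hreg : b' t₀ ≠ 0)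
    (hab'' : planeCross (b' t₀) (a'' s₀) = c ^ 2 * planeCross (b' t₀) (b'' t₀)) {l : Filter (ℝ × ℝ)}
    (hl : l ≤ 𝓝 (t₀, s₀))
    (hside : ∀ᶠ p in l, c * (p.2 - s₀) * (p.1 - t₀) ≤ 0 ∧ p ≠ (t₀, s₀)) :
    Tendsto (fun p => planeCross (b' p.1) (a p.2 - b p.1) / Complex.normSq (a p.2 - b p.1)) l
      (𝓝 (planeCross (b' t₀) (b'' t₀) / (2 * Complex.normSq (b' t₀)))) := by
  have hfst : Tendsto Prod.fst l (𝓝 t₀) := (continuous_fst.tendsto (t₀, s₀)).mono_left hl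
  have hsnd : Tendsto Prod.snd l (𝓝 s₀) := (continuous_snd.tendsto (t₀, s₀)).mono_left hl
  set A : ℝ × ℝ → ℂ := fun p => segmentRemainder a'' (s₀, p.2) with hA
  set B : ℝ × ℝ → ℂ := fun p => segmentRemainder b'' (t₀, p.1) with hB
  set B' : ℝ × ℝ → ℂ := fun p => segmentMean b'' (t₀, p.1) with hB'
  have hAl : Tendsto A l (𝓝 (a'' s₀ / 2)) := (ha.tendsto_segmentRemainder s₀).comp hsnd
  have hBl : Tendsto B l (𝓝 (b'' t₀ / 2)) := (hb.tendsto_segmentRemainder t₀).comp hfst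
  have hBl' : Tendsto B' l (𝓝 (b'' t₀)) := (hb.tendsto_segmentMean t₀).comp hfst
  set k := planeCross (b' t₀) (b'' t₀) with hk
  set β := b' t₀ with hβ
  set P : ℝ × ℝ → ℝ := fun p => p.2 - s₀ with hP
  set Q : ℝ × ℝ → ℝ := fun p => p.1 - t₀ with hQ
  have hPl : Tendsto P l (𝓝 0) := by simpa using hsnd.sub_const s₀
  have hQl : Tendsto Q l (𝓝 0) := by simpa using hfst.sub_const t₀
  -- To first order, `a p.2 - b p.1` is `D β`.
  set D : ℝ × ℝ → ℝ := fun p => c * P p - Q p with hD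
  -- The side condition gives `c P` and `Q` opposite signs, so `|D| = |c P| + |Q|`; hence `P / D`
  -- and `Q / D` stay bounded.
  have hDne : ∀ᶠ p in l, D p ≠ 0 ∧ |Q p| ≤ |D p| ∧ |c * P p| ≤ |D p| := by
    filter_upwards [hside] with p hp
    have h1 : c * P p * Q p ≤ 0 := hp.1
    have h2 : |Q p| ≤ |D p| := by
      rw [← sq_le_sq, hD]; nlinarith [sq_nonneg (c * P p)]
    have h3 : |c * P p| ≤ |D p| := by
      rw [← sq_le_sq, hD]; nlinarith [sq_nonneg (Q p)]
    refine ⟨fun h0 => hp.2 ?_, h2, h3⟩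
    rw [h0, abs_zero, abs_nonpos_iff] at h2 h3
    have h4 : P p = 0 := (mul_eq_zero.1 h3).resolve_left hc
    exact Prod.ext (sub_eq_zero.1 h2) (sub_eq_zero.1 h4)
  set x : ℝ × ℝ → ℝ := fun p => P p / D p with hx
  set y : ℝ × ℝ → ℝ := fun p => Q p / D p with hy
  have hyb : ∀ᶠ p in l, |y p| ≤ 1 := by
    filter_upwards [hDne] with p hp
    rw [hy, abs_div]
    exact div_le_one_of_le₀ hp.2.1 (abs_nonneg _)
  have hxb : ∀ᶠ p in l, |x p| ≤ 1 / |c| := by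
    filter_upwards [hDne] with p hp
    rw [hx, abs_div, div_le_div_iff₀ (abs_pos.2 hp.1) (abs_pos.2 hc), ← abs_mul, mul_comm, one_mul]
    exact hp.2.2
  have bdd : ∀ {z : ℝ × ℝ → ℝ} {M : ℝ}, (∀ᶠ p in l, |z p| ≤ M) → ∀ {g : ℝ × ℝ → ℝ},
      Tendsto g l (𝓝 0) → Tendsto (fun p => g p * z p) l (𝓝 0) := fun {z M} hz g hg =>
    hg.zero_mul_isBoundedUnder_le (isBoundedUnder_of_eventually_le hz)
  have bddC : ∀ {z : ℝ × ℝ → ℝ} {M : ℝ}, (∀ᶠ p in l, |z p| ≤ M) → ∀ {g : ℝ × ℝ → ℂ},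
      Tendsto g l (𝓝 0) → Tendsto (fun p => g p * (z p : ℂ)) l (𝓝 0) := fun {z M} hz g hg =>
    hg.zero_mul_isBoundedUnder_le (isBoundedUnder_of_eventually_le (a := M)
      (hz.mono fun p hp => by simpa using hp))
  have hPC : Tendsto (fun p => (P p : ℂ)) l (𝓝 0) := by
    simpa [Function.comp_def] using (Complex.continuous_ofReal.tendsto 0).comp hPl
  have hQC : Tendsto (fun p => (Q p : ℂ)) l (𝓝 0) := by
    simpa [Function.comp_def] using (Complex.continuous_ofReal.tendsto 0).comp hQl
  have hden : Tendsto (fun p => β + (P p : ℂ) * A p * (x p : ℂ) - (Q p : ℂ) * B p * (y p : ℂ)) l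
      (𝓝 β) := by
    have h1 := bddC hxb (by simpa using hPC.mul hAl)
    have h2 := bddC hyb (by simpa using hQC.mul hBl)
    simpa using (h1.const_add β).sub h2
  -- This is the numerator divided by `D²`. Neither `x` nor `y` need converge, but `c x - y = 1`
  -- makes the main part `(k / 2)(c² x² - y² - 2 y)` equal to `k / 2`; every other term is a null
  -- function times bounded ones.
  have hnum : Tendsto (fun p => k / 2 + ((planeCross β (A p) - c ^ 2 * k / 2) * x p) * x p
      - ((planeCross β (B p) - k / 2) * y p) * y p + (planeCross (B' p) β + k) * y p
      + ((Q p * planeCross (B' p) (A p)) * x p) * x p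
      - ((Q p * planeCross (B' p) (B p)) * y p) * y p) l
      (𝓝 (k / 2)) := by
    have hhalf : ∀ z w : ℂ, planeCross z (w / 2) = planeCross z w / 2 := fun z w => by
      simp [planeCross]; ring
    have hcomm : ∀ z w : ℂ, planeCross z w = -planeCross w z := fun z w => by
      simp only [planeCross]; ring
    have h1 : Tendsto (fun p => planeCross β (A p) - c ^ 2 * k / 2) l (𝓝 0) := by
      have := ((tendsto_const_nhds (x := β)).planeCross hAl).sub_const (c ^ 2 * k / 2)
      rwa [hhalf, hab'', sub_self] at this
    have h2 : Tendsto (fun p => planeCross β (B p) - k / 2) l (𝓝 0) := by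
      have := ((tendsto_const_nhds (x := β)).planeCross hBl).sub_const (k / 2)
      rwa [hhalf, ← hk, sub_self] at this
    have h3 : Tendsto (fun p => planeCross (B' p) β + k) l (𝓝 0) := by
      have := (hBl'.planeCross (tendsto_const_nhds (x := β))).add_const k
      rwa [hcomm, ← hk, neg_add_cancel] at this
    have h4 : Tendsto (fun p => Q p * planeCross (B' p) (A p)) l (𝓝 0) := by
      simpa using hQl.mul (hBl'.planeCross hAl)
    have h5 : Tendsto (fun p => Q p * planeCross (B' p) (B p)) l (𝓝 0) := by
      simpa using hQl.mul (hBl'.planeCross hBl)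
    simpa using (((((bdd hxb (bdd hxb h1)).const_add (k / 2)).sub (bdd hyb (bdd hyb h2))).add
      (bdd hyb h3)).add (bdd hxb (bdd hxb h4))).sub (bdd hyb (bdd hyb h5))
  have hlim := hnum.div ((Complex.continuous_normSq.tendsto β).comp hden)
    ((map_ne_zero Complex.normSq).2 hreg)
  rw [div_div] at hlim
  refine hlim.congr' ?_
  filter_upwards [hDne] with p hp
  have hw : a p.2 - b p.1 = (D p : ℂ) * (β + (P p : ℂ) * A p * (x p : ℂ) -
      (Q p : ℂ) * B p * (y p : ℂ)) := by
    have e1 := sub_eq_taylor_segmentRemainder ha.hasDerivAt ha.hasDerivAt' ha.continuous'' s₀ p.2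
    have e2 := sub_eq_taylor_segmentRemainder hb.hasDerivAt hb.hasDerivAt' hb.continuous'' t₀ p.1
    have e3 : a p.2 - b p.1 = (a p.2 - a s₀) - (b p.1 - b t₀) := by rw [hab]; ring
    have hx' : (x p : ℂ) * D p = P p := by
      rw [← Complex.ofReal_mul, hx]; exact congrArg _ (div_mul_cancel₀ _ hp.1)
    have hy' : (y p : ℂ) * D p = Q p := by
      rw [← Complex.ofReal_mul, hy]; exact congrArg _ (div_mul_cancel₀ _ hp.1)
    have hD' : (D p : ℂ) = c * P p - Q p := by rw [hD]; push_cast; rfl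
    change _ = (P p : ℂ) * a' s₀ + ((P p ^ 2 : ℝ) : ℂ) * A p at e1
    change _ = (Q p : ℂ) * β + ((Q p ^ 2 : ℝ) : ℂ) * B p at e2
    rw [e3, e1, e2, hab']
    push_cast
    linear_combination (-β) * hD' - (P p * A p) * hx' + (Q p * B p) * hy'
  have hb1 : b' p.1 = β + (Q p : ℂ) * B' p := by
    have := sub_eq_mul_segmentMean hb.hasDerivAt' hb.continuous'' t₀ p.1
    rw [← sub_eq_iff_eq_add']
    exact this
  have hxy : c * x p - y p = 1 := by
    rw [hx, hy]
    field_simp [hp.1]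
    rfl
  have hQy : Q p = y p * D p := (div_mul_cancel₀ _ hp.1).symm
  have hPx : P p = x p * D p := (div_mul_cancel₀ _ hp.1).symm
  have hcr : planeCross (b' p.1) (a p.2 - b p.1) = D p ^ 2 * (k / 2 +
      ((planeCross β (A p) - c ^ 2 * k / 2) * x p) * x p
      - ((planeCross β (B p) - k / 2) * y p) * y p + (planeCross (B' p) β + k) * y p
      + ((Q p * planeCross (B' p) (A p)) * x p) * x p
      - ((Q p * planeCross (B' p) (B p)) * y p) * y p) := by
    rw [hw, hb1]
    have : k / 2 - c ^ 2 * k / 2 * x p ^ 2 + k / 2 * y p ^ 2 + k * y p = 0 := by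
      linear_combination (-k / 2) * (c * x p + y p + 1) * hxy
    rw [hPx, hQy]
    simp only [planeCross, Complex.add_re, Complex.add_im, Complex.sub_re, Complex.sub_im,
      Complex.mul_re, Complex.mul_im, Complex.ofReal_re, Complex.ofReal_im]
    linear_combination (-D p ^ 2) * this
  simp only [Pi.div_apply, Function.comp_apply]
  rw [hcr]
  conv_rhs => rw [hw, map_mul, Complex.normSq_ofReal, ← pow_two]
  exact (mul_div_mul_left _ _ (pow_ne_zero 2 hp.1)).symm

end IsC2Curve

theorem arcCurvature_eq (σ : ℝ → ℂ) (t : ℝ) :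
    arcCurvature σ t = planeCross (arcD1 σ t) (arcD2 σ t) / ‖arcD1 σ t‖ ^ 3 := rfl

/-- Two arcs with the same tangent line and the same curvature at a common point, in terms of
derivatives; `η = 1` if they run in the same direction and `η = -1` otherwise. -/
theorem exists_smul_of_arcTangent_eq {a b : ℝ → ℂ} {s t η : ℝ} (hη : η ^ 2 = 1)
    (ha : arcD1 a s ≠ 0) (hb : arcD1 b t ≠ 0) (htan : arcTangent a s = η * arcTangent b t)
    (hcur : arcCurvature a s = η * arcCurvature b t) :
    ∃ c : ℝ, 0 < η * c ∧ arcD1 a s = c * arcD1 b t ∧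
      planeCross (arcD1 b t) (arcD2 a s) = c ^ 2 * planeCross (arcD1 b t) (arcD2 b t) := by
  have hna : 0 < ‖arcD1 a s‖ := norm_pos_iff.2 ha
  have hnb : 0 < ‖arcD1 b t‖ := norm_pos_iff.2 hb
  set r := ‖arcD1 a s‖ / ‖arcD1 b t‖ with hr
  have hr0 : 0 < r := div_pos hna hnb
  have hra : ‖arcD1 a s‖ = r * ‖arcD1 b t‖ := (div_mul_cancel₀ _ hnb.ne').symm
  have hD : arcD1 a s = (η * r : ℝ) * arcD1 b t := by
    have hna' : (‖arcD1 a s‖ : ℂ) ≠ 0 := Complex.ofReal_ne_zero.2 hna.ne'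
    rw [arcTangent, arcTangent, div_eq_iff hna'] at htan
    rw [htan, hr]
    push_cast
    ring
  refine ⟨η * r, ?_, hD, ?_⟩
  · rw [← mul_assoc, ← pow_two, hη, one_mul]; exact hr0
  -- The cross product scales by `r` and the cubed speed by `r³`, which leaves the factor `r² = c²`.
  · rw [arcCurvature_eq, arcCurvature_eq, hra, hD, planeCross_ofReal_mul_left] at hcur
    have hη0 : η ≠ 0 := by rintro rfl; norm_num at hη
    field_simp at hcur
    rw [mul_pow, hη, one_mul, hcur]

/-! ### Continuity of the kernels of a corner domain -/

namespace CornerDomain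

variable (Γ : CornerDomain)

/-- The determinant in the kernel is minus the cross product, whence the sign. -/
theorem K_eq (i j : Fin 3) (t s : ℝ) : Γ.K i j t s = -orient j *
    (if Γ.σ i s = Γ.σ j t then planeCross (arcD1 (Γ.σ j) t) (arcD2 (Γ.σ j) t) /
        (2 * Complex.normSq (arcD1 (Γ.σ j) t))
      else planeCross (arcD1 (Γ.σ j) t) (Γ.σ i s - Γ.σ j t) /
        Complex.normSq (Γ.σ i s - Γ.σ j t)) := by
  rw [K]
  split_ifs with h
  · rw [neg_mul_comm, Complex.normSq_apply, planeCross, ← neg_div, mul_comm 2, ← div_div]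
    ring
  · rw [neg_mul_comm, Complex.normSq_apply, planeCross, ← neg_div]
    simp only [Complex.sub_re, Complex.sub_im]
    ring

theorem continuousOn_K_self (j : Fin 3) :
    ContinuousOn (fun p : ℝ × ℝ => Γ.K j j p.1 p.2) (Icc 0 1 ×ˢ Icc 0 1) := by
  obtain ⟨f, f', f'', h, h0, h1, h2⟩ := exists_isC2Curve (Γ.contDiffOn_σ j)
  have hinj : InjOn f (Icc 0 1) := (Γ.injOn_σ j).congr h0
  have hreg : ∀ t ∈ Icc (0 : ℝ) 1, f' t ≠ 0 := fun t ht => h1 ht ▸ Γ.regular j t ht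
  refine ((h.continuousOn_planeCross_div hinj hreg).const_mul (-orient j)).congr ?_
  rintro ⟨t, s⟩ ⟨ht, hs⟩
  dsimp only at ht hs ⊢
  rw [K_eq, h0 ht, h0 hs, h1 ht, h2 ht]

theorem continuousWithinAt_K_of_ne {i j : Fin 3} {t s : ℝ} (ht : t ∈ Icc (0 : ℝ) 1)
    (hs : s ∈ Icc (0 : ℝ) 1) (hne : Γ.σ i s ≠ Γ.σ j t) :
    ContinuousWithinAt (fun p : ℝ × ℝ => Γ.K i j p.1 p.2) (Icc 0 1 ×ˢ Icc 0 1) (t, s) := by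
  have hi : ContinuousWithinAt (fun p : ℝ × ℝ => Γ.σ i p.2) (Icc 0 1 ×ˢ Icc 0 1) (t, s) :=
    ((Γ.contDiffOn_σ i).continuousOn s hs).comp continuous_snd.continuousWithinAt
      fun p hp => hp.2
  have hj : ContinuousWithinAt (fun p : ℝ × ℝ => Γ.σ j p.1) (Icc 0 1 ×ˢ Icc 0 1) (t, s) :=
    ((Γ.contDiffOn_σ j).continuousOn t ht).comp continuous_fst.continuousWithinAt
      fun p hp => hp.1
  have hj' : ContinuousWithinAt (fun p : ℝ × ℝ => arcD1 (Γ.σ j) p.1) (Icc 0 1 ×ˢ Icc 0 1)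
      (t, s) :=
    ((contDiffOn_arcD1 (Γ.contDiffOn_σ j)).continuousOn t ht).comp
      continuous_fst.continuousWithinAt fun p hp => hp.1
  have hsub := hi.sub hj
  have hsub0 : Γ.σ i s - Γ.σ j t ≠ 0 := sub_ne_zero.2 hne
  have hq : ContinuousWithinAt (fun p : ℝ × ℝ => -orient j *
      (planeCross (arcD1 (Γ.σ j) p.1) (Γ.σ i p.2 - Γ.σ j p.1) /
        Complex.normSq (Γ.σ i p.2 - Γ.σ j p.1))) (Icc 0 1 ×ˢ Icc 0 1) (t, s) :=
    tendsto_const_nhds.mul ((Filter.Tendsto.planeCross hj' hsub).div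
      ((Complex.continuous_normSq.tendsto _).comp hsub) ((map_ne_zero Complex.normSq).2 hsub0))
  refine hq.congr_of_eventuallyEq ?_ ?_
  · filter_upwards [hsub.eventually_ne hsub0] with p hp
    rw [K_eq, if_neg (sub_ne_zero.1 hp)]
  · rw [K_eq, if_neg hne]

/-- Continuity of the kernel at a point where two different arcs meet smoothly. -/
theorem continuousWithinAt_K_joint {i j : Fin 3} {t s η : ℝ} (ht : t ∈ Icc (0 : ℝ) 1)
    (hs : s ∈ Icc (0 : ℝ) 1) (hη : η ^ 2 = 1) (heq : Γ.σ i s = Γ.σ j t)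
    (hmeet : ∀ t' ∈ Icc (0 : ℝ) 1, ∀ s' ∈ Icc (0 : ℝ) 1, Γ.σ i s' = Γ.σ j t' → t' = t ∧ s' = s)
    (htan : arcTangent (Γ.σ i) s = η * arcTangent (Γ.σ j) t)
    (hcur : arcCurvature (Γ.σ i) s = η * arcCurvature (Γ.σ j) t)
    (hside : ∀ t' ∈ Icc (0 : ℝ) 1, ∀ s' ∈ Icc (0 : ℝ) 1, η * ((s' - s) * (t' - t)) ≤ 0) :
    ContinuousWithinAt (fun p : ℝ × ℝ => Γ.K i j p.1 p.2) (Icc 0 1 ×ˢ Icc 0 1) (t, s) := by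
  obtain ⟨a, a', a'', ha, ha0, ha1, ha2⟩ := exists_isC2Curve (Γ.contDiffOn_σ i)
  obtain ⟨b, b', b'', hb, hb0, hb1, hb2⟩ := exists_isC2Curve (Γ.contDiffOn_σ j)
  obtain ⟨c, hc, hD1, hD2⟩ := exists_smul_of_arcTangent_eq hη (Γ.regular i s hs)
    (Γ.regular j t ht) htan hcur
  have hc0 : c ≠ 0 := by rintro rfl; simp at hc
  have hreg := Γ.regular j t ht
  rw [ha1 hs, hb1 ht] at hD1
  rw [hb1 ht, hb2 ht, ha2 hs] at hD2
  rw [hb1 ht] at hreg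
  have hlim := ha.tendsto_planeCross_div hb (l := 𝓝[(Icc 0 1 ×ˢ Icc 0 1) \ {(t, s)}] (t, s)) hc0
    (by rw [← ha0 hs, ← hb0 ht, heq]) hD1 hreg hD2 nhdsWithin_le_nhds (by
      filter_upwards [self_mem_nhdsWithin] with p hp
      refine ⟨?_, hp.2⟩
      have h1 := hside p.1 hp.1.1 p.2 hp.1.2
      have h2 : c * (p.2 - s) * (p.1 - t) = (η * c) * (η * ((p.2 - s) * (p.1 - t))) := by
        linear_combination (-(c * (p.2 - s) * (p.1 - t))) * hη
      rw [h2]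
      exact mul_nonpos_of_nonneg_of_nonpos hc.le h1)
  -- At the joint itself the kernel takes its curvature branch, which is the limit found along the
  -- punctured square.
  rw [← continuousWithinAt_sdiff_self]
  have hval : Γ.K i j t s = -orient j * (planeCross (b' t) (b'' t) /
      (2 * Complex.normSq (b' t))) := by
    rw [K_eq, if_pos heq, hb1 ht, hb2 ht]
  change Tendsto _ _ (𝓝 (Γ.K i j t s))
  rw [hval]
  refine (hlim.const_mul (-orient j)).congr' ?_
  filter_upwards [self_mem_nhdsWithin] with p hp
  have hne : Γ.σ i p.2 ≠ Γ.σ j p.1 := fun h => hp.2 (by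
    obtain ⟨h1, h2⟩ := hmeet p.1 hp.1.1 p.2 hp.1.2 h
    exact Prod.ext h1 h2)
  rw [K_eq, if_neg hne, hb1 hp.1.1, ha0 hp.1.2, hb0 hp.1.1]

theorem meet_zero_one {s t : ℝ} (hs : s ∈ Icc (0 : ℝ) 1) (ht : t ∈ Icc (0 : ℝ) 1)
    (h : Γ.σ 0 s = Γ.σ 1 t) : s = 0 ∧ t = 0 := by
  have h0 : Γ.σ 0 s = Γ.σ 0 0 :=
    Γ.inter_zero_one ⟨mem_image_of_mem _ hs, h ▸ mem_image_of_mem _ ht⟩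
  exact ⟨Γ.injOn_σ 0 hs (by simp) h0, Γ.injOn_σ 1 ht (by simp) (by rw [← h, h0, Γ.corner])⟩

theorem meet_one_two {s t : ℝ} (hs : s ∈ Icc (0 : ℝ) 1) (ht : t ∈ Icc (0 : ℝ) 1)
    (h : Γ.σ 1 s = Γ.σ 2 t) : s = 1 ∧ t = 0 := by
  have h0 : Γ.σ 1 s = Γ.σ 1 1 :=
    Γ.inter_one_two ⟨mem_image_of_mem _ hs, h ▸ mem_image_of_mem _ ht⟩
  exact ⟨Γ.injOn_σ 1 hs (by simp) h0, Γ.injOn_σ 2 ht (by simp) (by rw [← h, h0, Γ.join_one_two])⟩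

theorem meet_zero_two {s t : ℝ} (hs : s ∈ Icc (0 : ℝ) 1) (ht : t ∈ Icc (0 : ℝ) 1)
    (h : Γ.σ 0 s = Γ.σ 2 t) : s = 1 ∧ t = 1 := by
  have h0 : Γ.σ 0 s = Γ.σ 0 1 :=
    Γ.inter_zero_two ⟨mem_image_of_mem _ hs, h ▸ mem_image_of_mem _ ht⟩
  exact ⟨Γ.injOn_σ 0 hs (by simp) h0, Γ.injOn_σ 2 ht (by simp) (by rw [← h, h0, Γ.join_zero_two])⟩

theorem continuousOn_K_of_joint {i j : Fin 3} {t s η : ℝ} (ht : t ∈ Icc (0 : ℝ) 1)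
    (hs : s ∈ Icc (0 : ℝ) 1) (hη : η ^ 2 = 1) (heq : Γ.σ i s = Γ.σ j t)
    (hmeet : ∀ t' ∈ Icc (0 : ℝ) 1, ∀ s' ∈ Icc (0 : ℝ) 1, Γ.σ i s' = Γ.σ j t' → t' = t ∧ s' = s)
    (htan : arcTangent (Γ.σ i) s = η * arcTangent (Γ.σ j) t)
    (hcur : arcCurvature (Γ.σ i) s = η * arcCurvature (Γ.σ j) t)
    (hside : ∀ t' ∈ Icc (0 : ℝ) 1, ∀ s' ∈ Icc (0 : ℝ) 1, η * ((s' - s) * (t' - t)) ≤ 0) :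
    ContinuousOn (fun p : ℝ × ℝ => Γ.K i j p.1 p.2) (Icc 0 1 ×ˢ Icc 0 1) := by
  rintro ⟨t', s'⟩ ⟨ht', hs'⟩
  by_cases h : Γ.σ i s' = Γ.σ j t'
  · obtain ⟨h1, h2⟩ := hmeet t' ht' s' hs' h
    subst h1 h2
    exact Γ.continuousWithinAt_K_joint ht hs hη heq hmeet htan hcur hside
  · exact Γ.continuousWithinAt_K_of_ne ht' hs' h

/-- Both arcs end at the joint, so they run in opposite directions (`η = -1`) and both parameter
increments are nonpositive. -/
theorem continuousOn_K_zero_two :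
    ContinuousOn (fun p : ℝ × ℝ => Γ.K 0 2 p.1 p.2) (Icc 0 1 ×ˢ Icc 0 1) := by
  refine Γ.continuousOn_K_of_joint (t := 1) (s := 1) (η := -1) (by simp) (by simp) (by norm_num)
    Γ.join_zero_two (fun t ht s hs h => (Γ.meet_zero_two hs ht h).symm) ?_ ?_ fun t ht s hs => ?_
  · simp [Γ.tangent_two_zero]
  · simp [Γ.curvature_two_zero]
  · nlinarith [mul_nonneg (sub_nonneg.2 ht.2) (sub_nonneg.2 hs.2)]

theorem continuousOn_K_two_zero :
    ContinuousOn (fun p : ℝ × ℝ => Γ.K 2 0 p.1 p.2) (Icc 0 1 ×ˢ Icc 0 1) := by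
  refine Γ.continuousOn_K_of_joint (t := 1) (s := 1) (η := -1) (by simp) (by simp) (by norm_num)
    Γ.join_zero_two.symm (fun t ht s hs h => Γ.meet_zero_two ht hs h.symm) ?_ ?_
    fun t ht s hs => ?_
  · simp [Γ.tangent_two_zero]
  · simp [Γ.curvature_two_zero]
  · nlinarith [mul_nonneg (sub_nonneg.2 ht.2) (sub_nonneg.2 hs.2)]

/-- One arc ends where the other begins, so the directions agree (`η = 1`) and the parameter
increments have opposite signs. -/
theorem continuousOn_K_one_two :
    ContinuousOn (fun p : ℝ × ℝ => Γ.K 1 2 p.1 p.2) (Icc 0 1 ×ˢ Icc 0 1) := by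
  refine Γ.continuousOn_K_of_joint (t := 0) (s := 1) (η := 1) (by simp) (by simp) (by norm_num)
    Γ.join_one_two (fun t ht s hs h => (Γ.meet_one_two hs ht h).symm) ?_ ?_ fun t ht s hs => ?_
  · simp [Γ.tangent_one_two]
  · simp [Γ.curvature_one_two]
  · nlinarith [mul_nonneg ht.1 (sub_nonneg.2 hs.2)]

theorem continuousOn_K_two_one :
    ContinuousOn (fun p : ℝ × ℝ => Γ.K 2 1 p.1 p.2) (Icc 0 1 ×ˢ Icc 0 1) := by
  refine Γ.continuousOn_K_of_joint (t := 1) (s := 0) (η := 1) (by simp) (by simp) (by norm_num)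
    Γ.join_one_two.symm (fun t ht s hs h => Γ.meet_one_two ht hs h.symm) ?_ ?_
    fun t ht s hs => ?_
  · simp [Γ.tangent_one_two]
  · simp [Γ.curvature_one_two]
  · nlinarith [mul_nonneg hs.1 (sub_nonneg.2 ht.2)]

/-! ### The wedge kernel and its difference from the double layer kernel -/

theorem neg_one_lt_cos : -1 < Real.cos (Γ.χ * Real.pi) := by
  rw [← Real.cos_abs, ← Real.cos_pi]
  refine Real.cos_lt_cos_of_nonneg_of_le_pi (abs_nonneg _) le_rfl ?_
  rw [abs_mul, abs_of_pos Real.pi_pos]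
  exact mul_lt_of_lt_one_left Real.pi_pos (abs_lt.2 ⟨Γ.neg_one_lt_χ, Γ.χ_lt_one⟩)

/-- The denominator is `(s - t)² + 2ts(1 + cos χπ)`, a sum of nonnegative terms; since `cos χπ >
-1`, both vanish only at the origin. -/
theorem L_denominator_ne_zero {t s : ℝ} (ht : 0 ≤ t) (hs : 0 ≤ s) (h : (t, s) ≠ (0, 0)) :
    s ^ 2 + 2 * t * s * Real.cos (Γ.χ * Real.pi) + t ^ 2 ≠ 0 := by
  have hcos := Γ.neg_one_lt_cos
  have hst : 0 ≤ t * s := mul_nonneg ht hs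
  intro h0
  have h1 : t * s * (1 + Real.cos (Γ.χ * Real.pi)) = 0 := by
    nlinarith [sq_nonneg (s - t), mul_nonneg hst (by linarith : 0 ≤ 1 + Real.cos (Γ.χ * Real.pi))]
  have h2 : t * s = 0 := (mul_eq_zero.1 h1).resolve_right (by linarith)
  have h3 : s ^ 2 + t ^ 2 = 0 := by
    linear_combination h0 - 2 * Real.cos (Γ.χ * Real.pi) * h2
  have h4 : s = 0 := by nlinarith [sq_nonneg s, sq_nonneg t]
  have h5 : t = 0 := by nlinarith [sq_nonneg s, sq_nonneg t]
  exact h (by rw [h4, h5])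

theorem continuousAt_L {t s : ℝ} (ht : 0 ≤ t) (hs : 0 ≤ s) (h : (t, s) ≠ (0, 0)) :
    ContinuousAt (fun p : ℝ × ℝ => Γ.L p.1 p.2) (t, s) := by
  unfold L
  exact ContinuousAt.div (by fun_prop) (by fun_prop) (Γ.L_denominator_ne_zero ht hs h)

theorem L_zero_right (t : ℝ) : Γ.L t 0 = 0 := by simp [L]

/-- Away from the origin the points on the two arcs are distinct and `L` is continuous, so only the
corner needs the hypothesis. -/
theorem continuousOn_M {i j : Fin 3} (hmeet : ∀ t ∈ Icc (0 : ℝ) 1, ∀ s ∈ Icc (0 : ℝ) 1,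
      Γ.σ i s = Γ.σ j t → (t, s) = (0, 0))
    (h : ContinuousWithinAt (fun p : ℝ × ℝ => Γ.M i j p.1 p.2)
      (Icc (0 : ℝ) 1 ×ˢ Icc (0 : ℝ) 1) (0, 0)) :
    ContinuousOn (fun p : ℝ × ℝ => Γ.M i j p.1 p.2) (Icc 0 1 ×ˢ Icc 0 1) := by
  rintro ⟨t, s⟩ ⟨ht, hs⟩
  by_cases h0 : (t, s) = (0, 0)
  · rw [h0]; exact h
  · exact (Γ.continuousWithinAt_K_of_ne ht hs fun h1 => h0 (hmeet t ht s hs h1)).sub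
      (Γ.continuousAt_L ht.1 hs.1 h0).continuousWithinAt

/-! ### The operators as kernel operators -/

/-- The kernels of the operator `𝒮`. -/
noncomputable def kernS (i j : Fin 3) (t s : ℝ) : ℝ :=
  if i = 0 ∧ j = 1 ∨ i = 1 ∧ j = 0 then Γ.M i j t s else Γ.K i j t s

theorem continuousOn_kernS
    (hM₁₂ : ContinuousWithinAt (fun p : ℝ × ℝ => Γ.M 0 1 p.1 p.2)
      (Icc (0 : ℝ) 1 ×ˢ Icc (0 : ℝ) 1) (0, 0))
    (hM₂₁ : ContinuousWithinAt (fun p : ℝ × ℝ => Γ.M 1 0 p.1 p.2)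
      (Icc (0 : ℝ) 1 ×ˢ Icc (0 : ℝ) 1) (0, 0)) (i j : Fin 3) :
    ContinuousOn (fun p : ℝ × ℝ => Γ.kernS i j p.1 p.2) (Icc 0 1 ×ˢ Icc 0 1) := by
  have h01 := Γ.continuousOn_M (i := 0) (j := 1) (fun t ht s hs h => by
    obtain ⟨h1, h2⟩ := Γ.meet_zero_one hs ht h
    rw [h1, h2]) hM₁₂
  have h10 := Γ.continuousOn_M (i := 1) (j := 0) (fun t ht s hs h => by
    obtain ⟨h1, h2⟩ := Γ.meet_zero_one ht hs h.symm
    rw [h1, h2]) hM₂₁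
  have h00 := Γ.continuousOn_K_self 0
  have h11 := Γ.continuousOn_K_self 1
  have h22 := Γ.continuousOn_K_self 2
  have h02 := Γ.continuousOn_K_zero_two
  have h20 := Γ.continuousOn_K_two_zero
  have h12 := Γ.continuousOn_K_one_two
  have h21 := Γ.continuousOn_K_two_one
  unfold kernS
  fin_cases i <;> fin_cases j <;> simpa [-Icc_prod_Icc]

/-- The kernels of the first two rows agree at the corner. -/
theorem kernS_corner (j : Fin 3) (t : ℝ) : Γ.kernS 0 j t 0 = Γ.kernS 1 j t 0 := by
  have h : ∀ j, Γ.K 0 j t 0 = Γ.K 1 j t 0 := fun j => by rw [K, K, Γ.corner]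
  unfold kernS M
  fin_cases j <;> simp [L_zero_right, h]

theorem discS_eq (m : ℕ) (ρ : TripleC) (i : Fin 3) (s : ℝ) :
    Γ.discS m ρ i s = ∑ j, lobattoSum m fun t => Γ.kernS i j t s * valueAt (ρ j) t := by
  rw [Fin.sum_univ_three]
  unfold discS kernS discK discM
  fin_cases i <;> simp

theorem intervalIntegrable_L_mul (f : C(Icc (0 : ℝ) 1, ℝ)) {s : ℝ} (hs : 0 ≤ s) :
    IntervalIntegrable (fun t => Γ.L t s * valueAt f t) volume 0 1 := by
  rcases hs.eq_or_lt with rfl | hs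
  · simp [L_zero_right]
  · refine ContinuousOn.intervalIntegrable fun t ht => ?_
    rw [uIcc_of_le zero_le_one] at ht
    have hc : ContinuousAt (fun t => Γ.L t s) t :=
      (Γ.continuousAt_L ht.1 hs.le (by simp [hs.ne'])).comp (f := fun t => (t, s))
        (Continuous.prodMk_left s).continuousAt
    exact (hc.mul (continuous_valueAt f).continuousAt).continuousWithinAt

/-- The terms `-π + Ω` cancel in the first two rows and vanish in the third. Integrals are split as
`K = M + L`, where `M` is continuous and `L` is integrable in `t` for each fixed `s`. -/
theorem opS_eq
    (hcont : ∀ i j, ContinuousOn (fun p : ℝ × ℝ => Γ.kernS i j p.1 p.2) (Icc 0 1 ×ˢ Icc 0 1))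
    (ρ : TripleC) (i : Fin 3) {s : ℝ} (hs : s ∈ Icc (0 : ℝ) 1) :
    Γ.opS ρ i s = ∑ j, ∫ t in (0 : ℝ)..1, Γ.kernS i j t s * valueAt (ρ j) t := by
  have hint : ∀ i j, IntervalIntegrable (fun t => Γ.kernS i j t s * valueAt (ρ j) t)
      volume 0 1 := fun i j => by
    refine ContinuousOn.intervalIntegrable ?_
    rw [uIcc_of_le zero_le_one]
    refine ContinuousOn.mul ?_ (continuous_valueAt _).continuousOn
    exact (hcont i j).comp (f := fun t => (t, s)) (Continuous.prodMk_left s).continuousOn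
      fun t ht => ⟨ht, hs⟩
  have hsplit : ∀ i j, (i = 0 ∧ j = 1 ∨ i = 1 ∧ j = 0) →
      ∫ t in (0 : ℝ)..1, Γ.kernS i j t s * valueAt (ρ j) t =
        (∫ t in (0 : ℝ)..1, Γ.K i j t s * valueAt (ρ j) t) - Γ.opL (ρ j) s := fun i j hij => by
    rw [eq_sub_iff_add_eq, opL, ← intervalIntegral.integral_add (hint i j)
      (Γ.intervalIntegrable_L_mul (ρ j) hs.1)]
    refine intervalIntegral.integral_congr fun t _ => ?_
    simp only [kernS, if_pos hij, M]
    ring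
  have hK : ∀ i j, ¬(i = 0 ∧ j = 1 ∨ i = 1 ∧ j = 0) → ∀ t, Γ.kernS i j t s = Γ.K i j t s :=
    fun i j hij t => if_neg hij
  rw [opS, opK, opW, Fin.sum_univ_three, Fin.sum_univ_three]
  fin_cases i
  · simp [hsplit 0 1 (by simp), hK 0 0 (by simp), hK 0 2 (by simp)]
    ring
  · simp [hsplit 1 0 (by simp), hK 1 1 (by simp), hK 1 2 (by simp)]
    ring
  · simp [Ω, hK 2 0 (by simp), hK 2 1 (by simp), hK 2 2 (by simp)]

/-- The kernels of `𝒮` as continuous families of continuous functions. -/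
noncomputable def kernSMap
    (hcont : ∀ i j, ContinuousOn (fun p : ℝ × ℝ => Γ.kernS i j p.1 p.2) (Icc 0 1 ×ˢ Icc 0 1))
    (i j : Fin 3) : C(Icc (0 : ℝ) 1, C(Icc (0 : ℝ) 1, ℝ)) :=
  -- The arguments are swapped so that currying makes the evaluation point `s` the outer variable
  -- and the integration variable `t` the inner one.
  ContinuousMap.curry ⟨fun p : Icc (0 : ℝ) 1 × Icc (0 : ℝ) 1 => Γ.kernS i j p.2 p.1,
    (hcont i j).comp_continuous (f := fun p : Icc (0 : ℝ) 1 × Icc (0 : ℝ) 1 =>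
      ((p.2 : ℝ), (p.1 : ℝ))) (by fun_prop) fun p => ⟨p.2.2, p.1.2⟩⟩

theorem valueAt_kernSMap_mul
    (hcont : ∀ i j, ContinuousOn (fun p : ℝ × ℝ => Γ.kernS i j p.1 p.2) (Icc 0 1 ×ˢ Icc 0 1))
    (i j : Fin 3) (s : Icc (0 : ℝ) 1) (f : C(Icc (0 : ℝ) 1, ℝ)) {t : ℝ}
    (ht : t ∈ Icc (0 : ℝ) 1) :
    valueAt (Γ.kernSMap hcont i j s * f) t = Γ.kernS i j t s * valueAt f t := by
  rw [valueAt_of_mem _ ht, valueAt_of_mem _ ht]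
  rfl

end CornerDomain

/-! ### Collective compactness and convergence -/

theorem theorem3p3 (Γ : CornerDomain)
    (hM₁₂ : ContinuousWithinAt (fun p : ℝ × ℝ => Γ.M 0 1 p.1 p.2)
      (Icc (0 : ℝ) 1 ×ˢ Icc (0 : ℝ) 1) (0, 0))
    (hM₂₁ : ContinuousWithinAt (fun p : ℝ × ℝ => Γ.M 1 0 p.1 p.2)
      (Icc (0 : ℝ) 1 ×ˢ Icc (0 : ℝ) 1) (0, 0)) :
    ∃ (S : spaceX →L[ℝ] spaceX) (Sm : ℕ → spaceX →L[ℝ] spaceX),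
      (∀ (ρ : spaceX) (i : Fin 3) (s : Icc (0 : ℝ) 1),
        (S ρ : TripleC) i s = Γ.opS ρ i s) ∧
      (∀ (m : ℕ) (ρ : spaceX) (i : Fin 3) (s : Icc (0 : ℝ) 1),
        (Sm m ρ : TripleC) i s = Γ.discS m ρ i s) ∧
      CollectivelyCompact (range Sm) ∧
      ∀ ρ : spaceX, Tendsto (fun m => ‖Sm m ρ - S ρ‖) atTop (𝓝 0) := by
  have hcont := Γ.continuousOn_kernS hM₁₂ hM₂₁
  -- Agreement of the first two rows at the corner keeps the images inside `𝒳`.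
  have hκ : ∀ j, Γ.kernSMap hcont 0 j ⟨0, left_mem_Icc.2 zero_le_one⟩ =
      Γ.kernSMap hcont 1 j ⟨0, left_mem_Icc.2 zero_le_one⟩ := fun j => by
    ext t
    exact Γ.kernS_corner j t
  refine ⟨blockOpX (Γ.kernSMap hcont) hκ integralCLM,
    fun m => blockOpX (Γ.kernSMap hcont) hκ (lobattoCLM m), fun ρ i s => ?_, fun m ρ i s => ?_,
    collectivelyCompact_blockOpX _ hκ norm_lobattoCLM_le,
    tendsto_norm_blockOpX_sub _ hκ norm_lobattoCLM_le tendsto_lobattoCLM⟩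
  · rw [coe_blockOpX, blockOp_apply_apply, Γ.opS_eq hcont _ _ s.2]
    refine Finset.sum_congr rfl fun j _ => ?_
    rw [integralCLM_apply]
    refine intervalIntegral.integral_congr fun t ht => ?_
    rw [uIcc_of_le zero_le_one] at ht
    exact Γ.valueAt_kernSMap_mul hcont i j s _ ht
  · rw [coe_blockOpX, blockOp_apply_apply, Γ.discS_eq]
    refine Finset.sum_congr rfl fun j _ => ?_
    rw [lobattoCLM_apply]
    exact Finset.sum_congr rfl fun t ht => congrArg _
      (Γ.valueAt_kernSMap_mul hcont i j s _ (mem_Icc_of_mem_lobattoNodes ht))
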